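/- Let $n\ge 1$, let $\mathbb K$ be $\mathbb R$ or $\mathbb C$, and let $\mathcal M$ be the space of smooth loops $S:S^1\to\mathfrak{sl}(n+1,\mathbb K)$. Indices of matrices run over $0,\dots,n$; covectors on $\mathcal M$ are loops $V$ in $\mathfrak{sl}(n+1,\mathbb K)$, paired with tangent vectors by $\langle V,\dot S\rangle=\oint\operatorname{tr}(V\dot S)\,dx$. Let $A$ be the matrix whose only nonzero entry is a $1$ in position $(n,0)$, and $B$ the matrix with ones on the superdiagonal and zeros elsewhere. Consider the compatible Poisson tensors $(P_0)_SV=[A,V]$ and $(P_1)_SV=V_x+[V,S]$, and the pencil $(P_\lambda)_SV=V_x+[V,S+\lambda A]$, i.e. $P_\lambda=P_1-\lambda P_0$, $\lambda\in\mathbb K$. Let $\mathcal S$ be the symplectic leaf of $P_0$ through $B$ (the affine space $B+\operatorname{im}\operatorname{ad}_A$), let $D=P_1(\ker P_0)$, $E_{\mathcal S}=D\cap T\mathcal S$, $\mathcal N=\mathcal S/E_{\mathcal S}$ and $\pi:\mathcal S\to\mathcal N$ the projection. Each leaf of $E_{\mathcal S}$ contains exactly one matrix $Q=Q(u)$ with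 superdiagonal entries $1$, last row $(u_0,\dots,u_{n-1},0)$ and all other entries $0$; so $\mathcal N$ is parametrized by $u=(u_0,\dots,u_{n-1})$, and the matrices $Q(u)$ form a submanifold $\mathcal Q$ of $\mathcal S$. Covectors on $\mathcal N$ are $n$-tuples $v$ of smooth functions on $S^1$, $\langle v,\dot u\rangle=\sum_{j<n}\oint v_j\dot u_j\,dx$. A lift of a covector $v$ of $\mathcal N$ at $\pi(S)$ to $S\in\mathcal S$ is a covector $\beta$ of $\mathcal M$ at $S$ that annihilates $D$ and satisfies $\langle\beta,\dot S\rangle=\langle v,d\pi(\dot S)\rangle$ for all $\dot S\in T_S\mathcal S$. The Marsden–Ratiu reduced tensors $P_0^{\mathcal N},P_1^{\mathcal N}$, and likewise $P_\lambda^{\mathcal N}=P_1^{\mathcal N}-\lambda P_0^{\mathcal N}$, are the unique tensors on $\mathcal N$ such that, for every $S\in\mathcal S$, every covector $v$ at $\pi(S)$ and every lift $\beta$ of $v$ to $S$, the vector $P_S\beta$ is tangent to $\mathcal S$ and $d\pi(P_S\beta)=P^{\mathcal N}v$. They exist. For all $\lambda$, $u$, $v$ there is a unique loop $\mathbb V=\phi(v)$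 in $\mathfrak{sl}(n+1,\mathbb K)$ such that $\mathbb V_x+[\mathbb V,Q(u)+\lambda A]\in T\mathcal Q$ and $\langle \mathbb V,\dot Q\rangle=\langle v,\dot u\rangle$ for every vector $\dot Q\in T\mathcal Q$ with components $\dot u$ in the last row; and $\mathbb V_x+[\mathbb V,Q(u)+\lambda A]$ is the vector of $T\mathcal Q$ with components $P^{\mathcal N}_\lambda v$. In the algebra of formal pseudodifferential operators $\sum_{i\le N}a_i\partial^i$ on $S^1$, with $(\cdot)_+$ the differential part and $\operatorname{res}$ the coefficient of $\partial^{-1}$, put $$L=\partial^{n+1}-\sum_{j=0}^{n-1}u_j\partial^j,\qquad E=\psi(\mathbb V)=-\sum_{j=0}^n\mathbb V_{0j}\,\partial^j,\qquad X=\xi(v)=-\sum_{j=0}^n\partial^{-j-1}\,\mathbb V_{jn},$$ and let $\frac{dL}{dt_i}=-\sum_{j<n}\dot u_j\partial^j$ with $\dot u=P_i^{\mathcal N}v$, $i=0,1$. Then $X$ represents $v$, that is, $\oint\operatorname{res}(X\dot L)\,dx=\langle v,\dot u\rangle$ for all $\dot u$, where $\dot L=-\sum_{j<n}\dot u_j\partial^j$.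 Moreover, $L$ has a unique two-sided inverse $L^{-1}$, and: (i) $E=(XL)_+$. (ii) $\dfrac{dL}{dt_1}=LE-(LEL^{-1})_+L$ and $\dfrac{dL}{dt_0}=E-(LEL^{-1})_+$. (iii) $\dfrac{dL}{dt_1}=L(XL)_+-(LX)_+L$ and $\dfrac{dL}{dt_0}=(XL)_+-(LX)_+=[X,L]_+$. Hence the reduced brackets are the Adler–Gel'fand–Dickey brackets: for covectors $v,v'$ at $u$ with $X=\xi(v)$ and $X'=\xi(v')$, $$\langle v',P_1^{\mathcal N}v\rangle=\oint\operatorname{res}\bigl(X'\,(L(XL)_+-(LX)_+L)\bigr)dx,\qquad \langle v',P_0^{\mathcal N}v\rangle=\oint\operatorname{res}\bigl(X'\,[X,L]_+\bigr)dx .$$ -/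

import Mathlib

open scoped ContDiff

noncomputable section

/-! ## Pseudodifferential operators over a commutative differential ring -/

namespace GelfandDickey

section PseudoDifferential

variable (R : Type*) [CommRing R] [Differential R]

/-- Coefficient sequences `(a i)`, `i ∈ ℤ`, that vanish for all large `i`. -/
def psiDO : AddSubgroup (ℤ → R) where
  carrier := {a | ∃ N : ℤ, ∀ i, N < i → a i = 0}
  zero_mem' := ⟨0, fun _ _ => rfl⟩
  add_mem' := by
    rintro a b ⟨N, hN⟩ ⟨M, hM⟩
    refine ⟨max N M, fun i hi => ?_⟩
    simp [hN i (lt_of_le_of_lt (le_max_left _ _) hi), hM i (lt_of_le_of_lt (le_max_right _ _) hi)]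
  neg_mem' := by
    rintro a ⟨N, hN⟩
    exact ⟨N, fun i hi => by simp [hN i hi]⟩

/-- Formal pseudodifferential operators `∑_{i ≤ N} a i ∂^i` with coefficients in `R`. -/
abbrev PsiDO : Type _ := ↥(psiDO R)

variable {R}

/-- The summand of the coefficient of `∂^m` in `A B` that comes from
`(a ∂^i) (b ∂^j) = ∑_k (i choose k) a b^{(k)} ∂^{i+j-k}`, where `p = (i, k)` and `j = m - i + k`. -/
def mulTerm (a b : ℤ → R) (m : ℤ) (p : ℤ × ℕ) : R :=
  Ring.choose p.1 p.2 • (a p.1 * (Differential.deriv (R := R))^[p.2] (b (m - p.1 + p.2)))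

/-- The coefficient of `∂^m` in the product; only finitely many summands are nonzero, see
`mulTerm_finite`. -/
def mulCoeff (a b : ℤ → R) (m : ℤ) : R := ∑ᶠ p : ℤ × ℕ, mulTerm a b m p

theorem mulTerm_eq_zero {a b : ℤ → R} {N M m : ℤ} (ha : ∀ i, N < i → a i = 0)
    (hb : ∀ i, M < i → b i = 0) {p : ℤ × ℕ} (hp : N < p.1 ∨ M < m - p.1 + p.2) :
    mulTerm a b m p = 0 := by
  unfold mulTerm
  rcases hp with h | h
  · simp [ha _ h]
  · have h0 : ∀ k : ℕ, (Differential.deriv (R := R))^[k] 0 = 0 := by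
      intro k
      induction k with
      | zero => rfl
      | succ k ih => rw [Function.iterate_succ_apply, map_zero, ih]
    simp [hb _ h, h0]

theorem mulTerm_finite {a b : ℤ → R} (ha : a ∈ psiDO R) (hb : b ∈ psiDO R) (m : ℤ) :
    (Function.support (mulTerm a b m)).Finite := by
  obtain ⟨N, hN⟩ := ha
  obtain ⟨M, hM⟩ := hb
  refine ((Set.finite_Icc (m - M) N).prod (Set.finite_Iic (M - m + N).toNat)).subset ?_
  intro p hp
  have h : ¬ (N < p.1 ∨ M < m - p.1 + p.2) := fun h => hp (mulTerm_eq_zero hN hM h)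
  simp only [Set.mem_prod, Set.mem_Icc, Set.mem_Iic]
  omega

theorem mulCoeff_mem {a b : ℤ → R} (ha : a ∈ psiDO R) (hb : b ∈ psiDO R) :
    mulCoeff a b ∈ psiDO R := by
  obtain ⟨N, hN⟩ := ha
  obtain ⟨M, hM⟩ := hb
  refine ⟨N + M, fun m hm => ?_⟩
  unfold mulCoeff
  rw [finsum_congr (g := fun _ => (0 : R)), finsum_zero]
  intro p
  exact mulTerm_eq_zero hN hM (by omega)

instance : Mul (PsiDO R) := ⟨fun A B => ⟨mulCoeff A.1 B.1, mulCoeff_mem A.2 B.2⟩⟩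

/-- The operator `f ∂^i`. -/
def mono (f : R) (i : ℤ) : PsiDO R :=
  ⟨Pi.single i f, i, fun j hj => by simp [hj.ne']⟩

instance : One (PsiDO R) := ⟨mono 1 0⟩

/-- The differential part `A₊`. -/
def plus (A : PsiDO R) : PsiDO R :=
  ⟨fun i => if 0 ≤ i then A.1 i else 0, by
    obtain ⟨N, hN⟩ := A.2
    exact ⟨N, fun i hi => by simp [hN i hi]⟩⟩

/-- The residue: the coefficient of `∂^{-1}`. -/
def res (A : PsiDO R) : R := A.1 (-1)

/-- `M` is a two-sided inverse of `L`. -/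
def IsInverse (L M : PsiDO R) : Prop := L * M = 1 ∧ M * L = 1

/-- The first (linear) Adler–Gel'fand–Dickey tensor `X ↦ [X, L]₊`. -/
def agd₀ (L X : PsiDO R) : PsiDO R := plus (X * L - L * X)

/-- The second (quadratic) Adler–Gel'fand–Dickey tensor `X ↦ L (X L)₊ - (L X)₊ L`. -/
def agd₁ (L X : PsiDO R) : PsiDO R := L * plus (X * L) - plus (L * X) * L

end PseudoDifferential

/-! ## Smooth functions on the circle -/

section Loops

variable (𝕜 : Type*) [RCLike 𝕜]

/-- Smooth functions on the circle `ℝ / 2πℤ`, as smooth `2π`-periodic functions on `ℝ`. -/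
def smoothLoop : Subalgebra 𝕜 (ℝ → 𝕜) where
  carrier := {f | ContDiff ℝ ∞ f ∧ Function.Periodic f (2 * Real.pi)}
  mul_mem' := fun hf hg => ⟨hf.1.mul hg.1, hf.2.mul hg.2⟩
  add_mem' := fun hf hg => ⟨hf.1.add hg.1, hf.2.add hg.2⟩
  algebraMap_mem' := fun _ => ⟨contDiff_const, fun _ => rfl⟩

/-- The ring `C^∞(S¹, 𝕜)`. -/
abbrev Loop : Type _ := ↥(smoothLoop 𝕜)

variable {𝕜}

theorem differentiable_loop (f : Loop 𝕜) : Differentiable ℝ f.1 :=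
  f.2.1.differentiable (by simp)

theorem deriv_mem_smoothLoop (f : Loop 𝕜) : deriv f.1 ∈ smoothLoop 𝕜 := by
  refine ⟨((contDiff_infty_iff_deriv (𝕜 := ℝ)).1 f.2.1).2, fun x => ?_⟩
  rw [← deriv_comp_add_const]
  congr 1
  exact funext f.2.2

/-- The derivation `d/dx` of `C^∞(S¹, 𝕜)`. -/
instance : Differential (Loop 𝕜) where
  deriv := Derivation.mk'
    (AddMonoidHom.toIntLinearMap
      { toFun := fun f => (⟨deriv f.1, deriv_mem_smoothLoop f⟩ : Loop 𝕜)
        map_zero' := Subtype.ext (funext fun x => by simp)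
        map_add' := fun f g => Subtype.ext (funext fun x => by
          exact deriv_add (differentiable_loop f x) (differentiable_loop g x)) })
    (fun f g => Subtype.ext (funext fun x => by
      have h := deriv_mul (differentiable_loop f x) (differentiable_loop g x)
      simp only [AddMonoidHom.coe_toIntLinearMap, AddMonoidHom.coe_mk, ZeroHom.coe_mk,
        Subalgebra.coe_add, Subalgebra.coe_mul, smul_eq_mul, Pi.add_apply, Pi.mul_apply]
      rw [h]
      ring))

/-- The integral over the circle. -/
def loopIntegral (f : Loop 𝕜) : 𝕜 := ∫ x in (0 : ℝ)..(2 * Real.pi), f.1 x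

/-- The Adler trace `∮ res A`. -/
def adlerTrace (A : PsiDO (Loop 𝕜)) : 𝕜 := loopIntegral (res A)

end Loops

/-! ## The bihamiltonian manifold of loops in `sl(n+1)` -/

section LoopAlgebra

/-- `(n+1) × (n+1)` matrices of functions on the circle. Points of the manifold `𝓜`, tangent
vectors and covectors are all matrices of this kind with trace zero. -/
abbrev Mat (𝕜 : Type*) [RCLike 𝕜] (n : ℕ) : Type _ :=
  Matrix (Fin (n + 1)) (Fin (n + 1)) (Loop 𝕜)

variable {𝕜 : Type*} [RCLike 𝕜] {n : ℕ}

/-- The entrywise derivative `V_x`. -/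
def matDeriv (V : Mat 𝕜 n) : Mat 𝕜 n := V.map (Differential.deriv (R := Loop 𝕜))

/-- The pairing `⟨V, Y⟩ = ∮ tr (V Y)` of covectors and tangent vectors. -/
def matPairing (V Y : Mat 𝕜 n) : 𝕜 := loopIntegral (V * Y).trace

variable (𝕜 n) in
/-- The element `A` of minimal weight: `1` in the lower left corner. -/
def matA : Mat 𝕜 n := Matrix.single (Fin.last n) 0 1

variable (𝕜 n) in
/-- The element `B`, the sum of the root vectors of the positive simple roots: ones on the
superdiagonal. -/
def matB : Mat 𝕜 n := Matrix.of fun i j => if j.val = i.val + 1 then 1 else 0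

/-- The Poisson tensor `(P₀)_S V = [A, V]`. -/
def P₀ (_S V : Mat 𝕜 n) : Mat 𝕜 n := ⁅matA 𝕜 n, V⁆

/-- The Poisson tensor `(P₁)_S V = V_x + [V, S]`. -/
def P₁ (S V : Mat 𝕜 n) : Mat 𝕜 n := matDeriv V + ⁅V, S⁆

/-- The pencil `V ↦ V_x + [V, S + λ A]`, which is `P₁ - λ P₀`. -/
def pencil (lam : 𝕜) (S V : Mat 𝕜 n) : Mat 𝕜 n := matDeriv V + ⁅V, S + lam • matA 𝕜 n⁆

/-! ## Marsden–Ratiu reduction -/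

variable (𝕜 n) in
/-- The characteristic distribution of `P₀`, the image of `ad A` (the same at every point). It is
the tangent space of the symplectic leaf `𝓢`. -/
def tangentS : Set (Mat 𝕜 n) := {Y | ∃ V : Mat 𝕜 n, V.trace = 0 ∧ ⁅matA 𝕜 n, V⁆ = Y}

variable (𝕜 n) in
/-- The symplectic leaf `𝓢` of `P₀` through `B`. -/
def leafS : Set (Mat 𝕜 n) := {S | S - matB 𝕜 n ∈ tangentS 𝕜 n}

/-- The distribution `D` at `S`: the image under `P₁` of the kernel of `P₀`. -/
def distD (S : Mat 𝕜 n) : Set (Mat 𝕜 n) :=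
  {Y | ∃ V : Mat 𝕜 n, V.trace = 0 ∧ P₀ S V = 0 ∧ P₁ S V = Y}

/-- The distribution `E` induced by `D` on `𝓢`. -/
def distE (S : Mat 𝕜 n) : Set (Mat 𝕜 n) := distD S ∩ tangentS 𝕜 n

/-- Two points of `𝓢` lie on the same integral leaf of `E`: a smooth curve in `𝓢` that is
everywhere tangent to `E` joins them. -/
def SameLeaf (S S' : Mat 𝕜 n) : Prop :=
  ∃ γ : ℝ → Mat 𝕜 n,
    (∀ i j, ContDiff ℝ ∞ fun p : ℝ × ℝ => (γ p.1 i j).1 p.2) ∧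
    γ 0 = S ∧ γ 1 = S' ∧
    ∀ t, γ t ∈ leafS 𝕜 n ∧ ∃ Y ∈ distE (γ t),
      ∀ i j x, HasDerivAt (fun s => (γ s i j).1 x) ((Y i j).1 x) t

/-- The matrix with last row `(w₀, …, w_{n-1}, 0)` and zeros elsewhere: the tangent vector of the
transversal submanifold `𝓠` with components `w`. -/
def lastRow (w : Fin n → Loop 𝕜) : Mat 𝕜 n :=
  Matrix.of fun i j =>
    if i = Fin.last n then (Fin.snoc (α := fun _ => Loop 𝕜) w 0 : Fin (n + 1) → Loop 𝕜) j else 0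

/-- The point `Q` of `𝓠` (the matrix in Frobenius form) with coordinates `u`. -/
def pointQ (u : Fin n → Loop 𝕜) : Mat 𝕜 n := matB 𝕜 n + lastRow u

/-- The projection `π : 𝓢 → 𝓝 = 𝓢 / E`, where a leaf of `E` is described by the coordinates `u` of
its point on `𝓠`: `Proj S u` means `π S = u`. -/
def Proj (S : Mat 𝕜 n) (u : Fin n → Loop 𝕜) : Prop := SameLeaf S (pointQ u)

/-- The tangent map of `π`: `TangentProj S Y w` means that `w` is the derivative at `ε = 0` of
`π (S + ε Y)`. -/
def TangentProj (S Y : Mat 𝕜 n) (w : Fin n → Loop 𝕜) : Prop :=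
  ∃ c : ℝ → Fin n → Loop 𝕜,
    (∀ ε : ℝ, Proj (S + (ε : 𝕜) • Y) (c ε)) ∧
    ∀ j x, HasDerivAt (fun ε => (c ε j).1 x) ((w j).1 x) 0

/-- The pairing `⟨v, w⟩ = ∑_j ∮ v_j w_j` of covectors and tangent vectors of `𝓝`. -/
def redPairing (v w : Fin n → Loop 𝕜) : 𝕜 := ∑ j, loopIntegral (v j * w j)

/-- The covector `β` of `𝓜` at `S ∈ 𝓢` lifts the covector `v` of `𝓝` at `π S`: it annihilates `D`,
and its restriction to the tangent space of `𝓢` is the pull-back of `v`. -/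
def IsLift (v : Fin n → Loop 𝕜) (S β : Mat 𝕜 n) : Prop :=
  β.trace = 0 ∧ (∀ Y ∈ distD S, matPairing β Y = 0) ∧
    ∀ Y ∈ tangentS 𝕜 n, ∀ w, TangentProj S Y w → matPairing β Y = redPairing v w

/-- `T` is the Marsden–Ratiu reduction of the tensor `P` to `𝓝`: whatever the point `S` of the leaf
`u` and the lift `β` of the covector `v` to `S`, the vector `P_S β` is tangent to `𝓢` and
projects onto `T u v`. -/
def IsReducedTensor (P : Mat 𝕜 n → Mat 𝕜 n → Mat 𝕜 n)
    (T : (Fin n → Loop 𝕜) → (Fin n → Loop 𝕜) → (Fin n → Loop 𝕜)) : Prop :=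
  ∀ (u v : Fin n → Loop 𝕜) (S β : Mat 𝕜 n), S ∈ leafS 𝕜 n → Proj S u → IsLift v S β →
    P S β ∈ tangentS 𝕜 n ∧ TangentProj S (P S β) (T u v)

/-- `V` is the value at the point `Q` with coordinates `u` of a lift of `v` in `Γ_𝓠`: the vector
`V_x + [V, Q + λ A]` is tangent to `𝓠`, and `V` restricts on the tangent space of `𝓠` to `v`. -/
def IsTransversalLift (lam : 𝕜) (u v : Fin n → Loop 𝕜) (V : Mat 𝕜 n) : Prop :=
  V.trace = 0 ∧ (∃ w, pencil lam (pointQ u) V = lastRow w) ∧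
    ∀ w, matPairing V (lastRow w) = redPairing v w

/-! ## The associated operators -/

/-- `L = ∂^{n+1} - ∑_{j<n} u_j ∂^j`. -/
def opL (u : Fin n → Loop 𝕜) : PsiDO (Loop 𝕜) :=
  mono 1 ((n : ℤ) + 1) - ∑ j : Fin n, mono (u j) (j.val : ℤ)

/-- The tangent vector `L̇ = - ∑_{j<n} w_j ∂^j` with components `w`. -/
def opLdot (w : Fin n → Loop 𝕜) : PsiDO (Loop 𝕜) :=
  -∑ j : Fin n, mono (w j) (j.val : ℤ)

/-- `E = ψ(V) = - ∑_{j ≤ n} V_{0 j} ∂^j`, from the first row of `V`. -/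
def opE (V : Mat 𝕜 n) : PsiDO (Loop 𝕜) :=
  -∑ j : Fin (n + 1), mono (V 0 j) (j.val : ℤ)

/-- `X = - ∑_{j ≤ n} ∂^{-j-1} V_{j n}` (operator products), from the last column of `V`. -/
def opX (V : Mat 𝕜 n) : PsiDO (Loop 𝕜) :=
  -∑ j : Fin (n + 1), mono 1 (-(j.val : ℤ) - 1) * mono (V j (Fin.last n)) 0

end LoopAlgebra

end GelfandDickey

end

open GelfandDickey

open scoped ContDiff Differential

namespace GelfandDickey

noncomputable section

set_option linter.unusedSectionVars false

/-! ## The ring of pseudodifferential operators -/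

section PsiDORing

variable {R : Type*} [CommRing R]

/-! Everything rests on one gauge picture. The leaf consists of the traceless matrices that agree
with `B` off the last row and the first column (`mem_leafS`). A covector in the kernel of `P₀` whose
image under `P₁` is tangent to the leaf is strictly lower triangular (`strictLower_of_P₁`), so `E`
is generated by infinitesimal gauge transformations, and its leaves are orbits of lower
unitriangular gauge transformations. The normal form of `S` is reached by the matrix whose rows are
the iterated covariant derivatives of the first basis row. The resulting `invariants` are constant
on leaves, since a strictly lower triangular `W` with `P₁ Q W` tangent to the transversal must
vanish (`eq_zero_of_P₁_eq_lastRow`), and an affine path of gauge matrices joins each `S` to its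
normal form (`sameLeaf_frob`). Hence `π` and its differential become explicit (`proj_iff`,
`tangentProj_iff`).

Because the first `n` rows of `Q + λA` are shifts, a transversal lift satisfies `V_{i+1} = V_i' +
V_i (Q + λA)`: its first row generates it, and a triangular recursion together with the trace
condition recovers that row from `v`. Any other lift, conjugated to the point `Q`, differs from it
by a strictly lower triangular matrix, which `P₀` kills and `dπ ∘ P₁` does not see
(`dInvariants_lift`). This gives the reduced tensors. It also shows that the first row and last
column of `V`, hence `E` and `X`, do not depend on `λ`.

For the operators, send a row `y` to `∑ y_j ∂^j`. Then `∂` acts as the covariant derivative up to a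
left multiple of `L - λ` (`d_mul_rowOp`). Iterating from the first row, the quotients accumulate to
`(∂^k X)₊` (`rowOp_iterate`), because the coefficient added at each step is a residue of `∂^k X`. At
`k = n + 1` this yields `E = (X L)₊`, and the last row of the pencil equation yields `(L - λ) E - (L
X)₊ (L - λ)` for the flow. Comparing `λ = 0` with `λ = 1` separates the two tensors. Finally `(L E
L⁻¹)₊ = (L X)₊`, since `E` differs from `X L` by an operator of negative order. -/

/-- `A` has order at most `N`. -/
def OrdLE (A : PsiDO R) (N : ℤ) : Prop := ∀ i, N < i → A.1 i = 0

theorem exists_ordLE (A : PsiDO R) : ∃ N, OrdLE A N := A.2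

theorem OrdLE.mono {A : PsiDO R} {N M : ℤ} (h : OrdLE A N) (hNM : N ≤ M) : OrdLE A M :=
  fun i hi => h i (lt_of_le_of_lt hNM hi)

theorem OrdLE.add {A B : PsiDO R} {N : ℤ} (hA : OrdLE A N) (hB : OrdLE B N) : OrdLE (A + B) N :=
  fun i hi => by simp [hA i hi, hB i hi]

theorem OrdLE.neg {A : PsiDO R} {N : ℤ} (hA : OrdLE A N) : OrdLE (-A) N :=
  fun i hi => by simp [hA i hi]

theorem OrdLE.sub {A B : PsiDO R} {N : ℤ} (hA : OrdLE A N) (hB : OrdLE B N) : OrdLE (A - B) N :=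
  fun i hi => by simp [hA i hi, hB i hi]

theorem ordLE_zero (N : ℤ) : OrdLE (0 : PsiDO R) N := fun _ _ => rfl

theorem OrdLE.sum {ι : Type*} {s : Finset ι} {A : ι → PsiDO R} {N : ℤ}
    (h : ∀ i ∈ s, OrdLE (A i) N) : OrdLE (∑ i ∈ s, A i) N :=
  Finset.sum_induction A (OrdLE · N) (fun _ _ => OrdLE.add) (ordLE_zero N) h

theorem ordLE_mono (f : R) (i : ℤ) : OrdLE (mono f i) i :=
  fun j hj => by simp [GelfandDickey.mono, hj.ne']

theorem eq_zero_of_ordLE {A : PsiDO R} (h : ∀ N, OrdLE A N) : A = 0 :=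
  Subtype.ext (funext fun i => h (i - 1) i (by omega))

/-- Splitting off finitely many monomials. -/
theorem exists_sum_mono_add (A : PsiDO R) (K : ℤ) :
    ∃ (s : Finset ℤ) (A' : PsiDO R), OrdLE A' K ∧ A = ∑ i ∈ s, mono (A.1 i) i + A' := by
  obtain ⟨N, hN⟩ := A.2
  refine ⟨Finset.Ioc K N, A - ∑ i ∈ Finset.Ioc K N, mono (A.1 i) i, fun i hi => ?_, by abel⟩
  have : (∑ i ∈ Finset.Ioc K N, mono (A.1 i) i : PsiDO R).1 i =
      ∑ j ∈ Finset.Ioc K N, (mono (A.1 j) j).1 i := by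
    rw [AddSubgroup.val_finsetSum, Finset.sum_apply]
  change A.1 i - _ = 0
  rw [this]
  simp only [mono, Pi.single_apply, Finset.sum_ite_eq, Finset.mem_Ioc]
  by_cases h : i ≤ N
  · simp [h, hi]
  · simp [h, hN i (not_le.1 h)]

variable [Differential R]

theorem mul_coeff (A B : PsiDO R) (m : ℤ) : (A * B).1 m = ∑ᶠ p, mulTerm A.1 B.1 m p := rfl

theorem OrdLE.mul {A B : PsiDO R} {N M : ℤ} (hA : OrdLE A N) (hB : OrdLE B M) :
    OrdLE (A * B) (N + M) := fun m hm => by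
  rw [mul_coeff, finsum_congr (g := fun _ => (0 : R)), finsum_zero]
  intro p
  exact mulTerm_eq_zero hA hB (by omega)

theorem psiDO_add_mul (A B C : PsiDO R) : (A + B) * C = A * C + B * C := by
  refine Subtype.ext (funext fun m => ?_)
  change _ = (A * C).1 m + (B * C).1 m
  rw [mul_coeff, mul_coeff, mul_coeff, ← finsum_add_distrib (mulTerm_finite A.2 C.2 m)
    (mulTerm_finite B.2 C.2 m)]
  refine finsum_congr fun p => ?_
  simp [mulTerm, add_mul]

theorem psiDO_mul_add (A B C : PsiDO R) : A * (B + C) = A * B + A * C := by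
  refine Subtype.ext (funext fun m => ?_)
  change _ = (A * B).1 m + (A * C).1 m
  rw [mul_coeff, mul_coeff, mul_coeff, ← finsum_add_distrib (mulTerm_finite A.2 B.2 m)
    (mulTerm_finite A.2 C.2 m)]
  refine finsum_congr fun p => ?_
  have : ∀ (k : ℕ) (f g : R), (Differential.deriv (R := R))^[k] (f + g) =
      (Differential.deriv (R := R))^[k] f + (Differential.deriv (R := R))^[k] g :=
    fun k => iterate_map_add (Differential.deriv (R := R)) k
  simp [mulTerm, mul_add, this]

theorem iterate_deriv_zero (k : ℕ) : (Differential.deriv (R := R))^[k] 0 = 0 :=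
  iterate_map_zero (Differential.deriv (R := R)) k

theorem psiDO_zero_mul (A : PsiDO R) : 0 * A = 0 := by
  have := psiDO_add_mul 0 0 A
  simpa using this

theorem psiDO_mul_zero (A : PsiDO R) : A * 0 = 0 := by
  have := psiDO_mul_add A 0 0
  simpa using this

/-- With a single monomial on the left only the order of differentiation still varies. The set `s`
is left free so that each application can supply the few orders that survive. -/
theorem mono_mul_coeff (f : R) (i : ℤ) (A : PsiDO R) (m : ℤ) {s : Finset ℕ}
    (hs : ∀ k ∉ s, Ring.choose i k • (f * (Differential.deriv (R := R))^[k] (A.1 (m - i + k))) = 0) :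
    (mono f i * A).1 m =
      ∑ k ∈ s, Ring.choose i k • (f * (Differential.deriv (R := R))^[k] (A.1 (m - i + k))) := by
  classical
  rw [mul_coeff, finsum_eq_sum_of_support_subset (s := s.image fun k => (i, k)),
    Finset.sum_image (fun a _ b _ h => by simpa using h)]
  · simp [mulTerm, mono]
  · rintro ⟨j, k⟩ h
    by_cases hj : j = i
    · subst hj
      by_contra hk
      refine h ?_
      have := hs k (fun h => hk (by simpa using h))
      simpa [mulTerm, mono] using this
    · exact absurd (by simp [mulTerm, mono, hj]) h

theorem fun_mul_coeff (f : R) (A : PsiDO R) (m : ℤ) : (mono f 0 * A).1 m = f * A.1 m := by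
  rw [mono_mul_coeff (s := {0})]
  · simp
  · intro k hk
    obtain ⟨k, rfl⟩ := Nat.exists_eq_succ_of_ne_zero (by simpa using hk)
    rw [Ring.choose_zero_succ, zero_smul]

theorem choose_one_add_two (k : ℕ) : Ring.choose (1 : ℤ) (k + 2) = 0 := by
  have := Ring.choose_natCast (R := ℤ) 1 (k + 2)
  rw [Nat.choose_eq_zero_of_lt (by omega)] at this
  simpa using this

theorem d_mul_coeff (A : PsiDO R) (m : ℤ) :
    (mono 1 1 * A).1 m = (A.1 m)′ + A.1 (m - 1) := by
  rw [mono_mul_coeff (s := {0, 1})]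
  · simp [add_comm]
  · intro k hk
    simp only [Finset.mem_insert, Finset.mem_singleton, not_or] at hk
    obtain ⟨k, rfl⟩ := Nat.exists_eq_add_of_le (show 2 ≤ k by omega)
    rw [add_comm, choose_one_add_two, zero_smul]

theorem mono_mul_const {c : R} (hc : c′ = 0) (f : R) (i j : ℤ) :
    mono f i * mono c j = mono (f * c) (i + j) := by
  refine Subtype.ext (funext fun m => ?_)
  have h : ∀ (k : ℕ) (l : ℤ), (Differential.deriv (R := R))^[k + 1] ((mono c j).1 l) = 0 := by
    intro k l
    rw [Function.iterate_succ_apply]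
    by_cases hl : l = j
    · subst hl
      simp [mono, hc]
    · simp [mono, hl]
  rw [mono_mul_coeff (s := {0})]
  · by_cases hm : m = i + j
    · subst hm
      simp [mono]
    · simp [mono, hm, show m - i ≠ j by omega]
  · intro k hk
    obtain ⟨k, rfl⟩ := Nat.exists_eq_succ_of_ne_zero (by simpa using hk)
    rw [Nat.succ_eq_add_one, h, mul_zero, smul_zero]

theorem mono_mul_one_mono (f : R) (i j : ℤ) : mono f i * mono 1 j = mono f (i + j) := by
  rw [mono_mul_const (by simp), mul_one]

theorem psiDO_mul_one (A : PsiDO R) : A * 1 = A := by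
  refine Subtype.ext (funext fun m => ?_)
  rw [mul_coeff, finsum_eq_single _ (m, 0)]
  · simp [mulTerm, show (1 : PsiDO R) = mono 1 0 from rfl, mono]
  · rintro ⟨i, k⟩ h
    rw [show (1 : PsiDO R) = mono 1 0 from rfl]
    rcases k with _ | k
    · have : m - i ≠ 0 := fun h0 => h (by simp; omega)
      simp [mulTerm, mono, this]
    · by_cases h0 : m - i + ((k + 1 : ℕ) : ℤ) = 0
      · simp only [mulTerm, h0, mono, Function.iterate_succ_apply]
        simp
      · simp only [mulTerm, mono, Pi.single_eq_of_ne h0, iterate_deriv_zero, mul_zero, smul_zero]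

theorem psiDO_one_mul (A : PsiDO R) : 1 * A = A :=
  Subtype.ext (funext fun m => (fun_mul_coeff 1 A m).trans (one_mul _))

theorem finsum_eq_of_injective {α β : Type*} {M : Type*} [AddCommMonoid M] {g : α → β}
    (hg : Function.Injective g) {f : β → M} (hf : ∀ b ∉ Set.range g, f b = 0) :
    ∑ᶠ b, f b = ∑ᶠ a, f (g a) := by
  rw [← finsum_mem_range hg]
  refine finsum_congr fun b => ?_
  by_cases hb : b ∈ Set.range g
  · simp [hb]
  · simp [hf b hb]

theorem fun_mul_assoc (f : R) (B C : PsiDO R) : mono f 0 * B * C = mono f 0 * (B * C) := by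
  refine Subtype.ext (funext fun m => ?_)
  rw [fun_mul_coeff, mul_coeff, mul_coeff, mul_finsum' _ _ (mulTerm_finite B.2 C.2 m)]
  refine finsum_congr fun p => ?_
  simp only [mulTerm, fun_mul_coeff, mul_smul_comm, mul_assoc]

/-- Left multiplication by `∂` differentiates the coefficients and shifts them. The Leibniz rule
splits the derivative of a coefficient of `B C`; the part that differentiates `C` once more combines
with the shifted part by Pascal's rule. -/
theorem d_mul_assoc (B C : PsiDO R) : mono 1 1 * B * C = mono 1 1 * (B * C) := by
  refine Subtype.ext (funext fun m => ?_)
  obtain ⟨N, hN⟩ := B.2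
  obtain ⟨M, hM⟩ := C.2
  set G : ℤ × ℕ → R := fun p => Ring.choose p.1 p.2 •
    (B.1 p.1 * (Differential.deriv (R := R))^[p.2 + 1] (C.1 (m - p.1 + p.2))) with hG
  have hGfin : (Function.support G).Finite := by
    refine ((Set.finite_Icc (m - M) N).prod (Set.finite_Iic (M - m + N).toNat)).subset ?_
    intro p hp
    have h : ¬ (N < p.1 ∨ M < m - p.1 + p.2) := by
      rintro (h | h)
      · exact hp (by simp [hG, hN _ h])
      · exact hp (by simp [hG, hM _ h])
    simp only [Set.mem_prod, Set.mem_Icc, Set.mem_Iic]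
    omega
  let B' : PsiDO R := ⟨fun i => (B.1 i)′, N, fun i hi => by simp [hN i hi]⟩
  let B₁ : PsiDO R := ⟨fun i => B.1 (i - 1), N + 1, fun i hi => hN _ (by omega)⟩
  have hDB : mono 1 1 * B = B' + B₁ := Subtype.ext (funext fun i => d_mul_coeff B i)
  have hder : ((B * C).1 m)′ = (B' * C).1 m + ∑ᶠ p, G p := by
    rw [mul_coeff, mul_coeff, ← finsum_add_distrib (mulTerm_finite B'.2 C.2 m) hGfin]
    refine ((Differential.deriv (R := R)).toLinearMap.toAddMonoidHom.map_finsum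
      (mulTerm_finite B.2 C.2 m)).trans (finsum_congr fun p => ?_)
    change (mulTerm B.1 C.1 m p)′ = _
    simp only [mulTerm, hG, Function.iterate_succ_apply', B', map_zsmul, Derivation.leibniz,
      smul_eq_mul, ← smul_add]
    congr 1
    rw [add_comm, mul_comm (Differential.deriv _)]
  rw [d_mul_coeff, hDB, psiDO_add_mul, hder, add_assoc]
  change (B' * C).1 m + (B₁ * C).1 m = _
  congr 1
  have h1 : (B₁ * C).1 m = ∑ᶠ p : ℤ × ℕ, Ring.choose (p.1 + 1) p.2 •
      (B.1 p.1 * (Differential.deriv (R := R))^[p.2] (C.1 (m - 1 - p.1 + p.2))) := by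
    rw [mul_coeff]
    refine finsum_eq_of_bijective (fun p : ℤ × ℕ => (p.1 - 1, p.2))
      ((Equiv.subRight (1 : ℤ)).prodCongr (Equiv.refl ℕ)).bijective fun p => ?_
    simp only [mulTerm, B₁, sub_add_cancel]
    rw [show m - 1 - (p.1 - 1) = m - p.1 by ring]
  -- `G` reindexed by the total number of derivatives on `C`, extended by zero at `k = 0`, so that
  -- Pascal's rule applies term by term.
  set G' : ℤ × ℕ → R := fun p => if p.2 = 0 then 0 else Ring.choose p.1 (p.2 - 1) •
    (B.1 p.1 * (Differential.deriv (R := R))^[p.2] (C.1 (m - 1 - p.1 + p.2))) with hG'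
  have hinj : Function.Injective (fun p : ℤ × ℕ => (p.1, p.2 + 1)) := by
    rintro ⟨a, b⟩ ⟨c, d⟩ h
    simpa using h
  have hG0 : ∀ p ∉ Set.range (fun p : ℤ × ℕ => (p.1, p.2 + 1)), G' p = 0 := by
    rintro ⟨i, k⟩ hp
    rcases k with _ | k
    · simp [hG']
    · exact absurd ⟨(i, k), rfl⟩ hp
  have hGc : ∀ p : ℤ × ℕ, G' (p.1, p.2 + 1) = G p := by
    rintro ⟨i, k⟩
    simp only [hG', hG, Nat.add_eq_zero_iff, one_ne_zero, and_false, if_false,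
      Nat.add_sub_cancel]
    rw [show m - 1 - i + ((k + 1 : ℕ) : ℤ) = m - i + k by push_cast; ring]
  have h2 : ∑ᶠ p, G p = ∑ᶠ p, G' p := by
    rw [finsum_eq_of_injective hinj hG0]
    exact finsum_congr fun p => (hGc p).symm
  have hG'fin : (Function.support G').Finite := by
    refine (hGfin.image (fun p : ℤ × ℕ => (p.1, p.2 + 1))).subset fun p hp => ?_
    by_cases hr : p ∈ Set.range (fun p : ℤ × ℕ => (p.1, p.2 + 1))
    · obtain ⟨q, rfl⟩ := hr
      exact ⟨q, by rwa [Function.mem_support, ← hGc], rfl⟩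
    · exact absurd (hG0 p hr) hp
  rw [h1, h2, mul_coeff, ← finsum_add_distrib hG'fin (mulTerm_finite B.2 C.2 (m - 1))]
  refine finsum_congr fun p => ?_
  rcases p with ⟨i, _ | k⟩
  · simp [hG', mulTerm]
  · simp only [hG', mulTerm, Nat.add_eq_zero_iff, one_ne_zero, and_false, if_false,
      Nat.add_sub_cancel, Ring.choose_succ_succ, add_smul]

/-- The coefficient of `∂^{i+1}` in `∂ A` is `a_{i+1}' + a_i`, so vanishing propagates downwards
from the top order. -/
theorem d_mul_injective {A : PsiDO R} (h : mono 1 1 * A = 0) : A = 0 := by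
  obtain ⟨N, hN⟩ := A.2
  have key : ∀ k : ℕ, OrdLE A (N - k) := by
    intro k
    induction k with
    | zero => exact OrdLE.mono hN (by simp)
    | succ k ih =>
      intro i hi
      by_cases hik : N - k < i
      · exact ih i hik
      · have := congrArg (fun B : PsiDO R => B.1 (i + 1)) h
        simp only [d_mul_coeff, add_sub_cancel_right] at this
        rw [ih (i + 1) (by push_cast at hi; omega), map_zero, zero_add] at this
        exact this
  refine eq_zero_of_ordLE fun M => (key (N - M).toNat).mono (by omega)

/-- The operators `A` with `(A B) C = A (B C)` for all `B` and `C`. -/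
def LeftNucleus (A : PsiDO R) : Prop := ∀ B C : PsiDO R, A * B * C = A * (B * C)

theorem LeftNucleus.mul {A B : PsiDO R} (hA : LeftNucleus A) (hB : LeftNucleus B) :
    LeftNucleus (A * B) := fun C D => by rw [hA, hA, hB, hA]

theorem LeftNucleus.add {A B : PsiDO R} (hA : LeftNucleus A) (hB : LeftNucleus B) :
    LeftNucleus (A + B) := fun C D => by
  rw [psiDO_add_mul, psiDO_add_mul, psiDO_add_mul, hA, hB]

theorem leftNucleus_zero : LeftNucleus (0 : PsiDO R) := fun C D => by
  rw [psiDO_zero_mul, psiDO_zero_mul, psiDO_zero_mul]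

/-- Left multiplication by `∂` is injective and already associates, so the identity for `∂⁻¹` can be
checked after multiplying by `∂`. -/
theorem leftNucleus_dInv : LeftNucleus (mono 1 (-1) : PsiDO R) := fun B C => by
  have h : ∀ A : PsiDO R, mono 1 1 * (mono 1 (-1) * A) = A := fun A => by
    rw [← d_mul_assoc, mono_mul_one_mono]
    exact psiDO_one_mul A
  refine sub_eq_zero.1 (d_mul_injective ?_)
  rw [sub_eq_add_neg, psiDO_mul_add, ← d_mul_assoc, ← d_mul_assoc, mono_mul_one_mono]
  have hneg : ∀ X Y : PsiDO R, X * (-Y) = -(X * Y) := fun X Y => by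
    refine eq_neg_of_add_eq_zero_left ?_
    rw [← psiDO_mul_add, neg_add_cancel, psiDO_mul_zero]
  rw [hneg, h, show mono (1 : R) (1 + -1) = 1 from rfl, psiDO_one_mul, add_neg_cancel]

theorem leftNucleus_mono (f : R) (i : ℤ) : LeftNucleus (mono f i) := by
  have hpow : LeftNucleus (mono 1 i : PsiDO R) := by
    induction i with
    | zero => exact fun_mul_assoc 1
    | succ i ih =>
      rw [← mono_mul_one_mono]
      exact LeftNucleus.mul ih d_mul_assoc
    | pred i ih =>
      rw [sub_eq_add_neg, ← mono_mul_one_mono]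
      exact LeftNucleus.mul ih leftNucleus_dInv
  have := LeftNucleus.mul (fun_mul_assoc f) hpow
  rwa [mono_mul_one_mono, zero_add] at this

/-- Finite sums of monomials associate on the left. Every operator is such a sum up to a remainder
of arbitrarily low order, so the associator has arbitrarily low order. -/
theorem psiDO_mul_assoc (A B C : PsiDO R) : A * B * C = A * (B * C) := by
  obtain ⟨M, hM⟩ := exists_ordLE B
  obtain ⟨P, hP⟩ := exists_ordLE C
  refine sub_eq_zero.1 (eq_zero_of_ordLE fun K => ?_)
  obtain ⟨s, A', hA', hA⟩ := exists_sum_mono_add A (K - M - P)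
  have hs : LeftNucleus (∑ i ∈ s, mono (A.1 i) i) :=
    Finset.sum_induction _ LeftNucleus (fun _ _ => LeftNucleus.add) leftNucleus_zero
      fun i _ => leftNucleus_mono _ _
  rw [hA, psiDO_add_mul, psiDO_add_mul, psiDO_add_mul, hs, add_sub_add_left_eq_sub]
  refine OrdLE.sub (((hA'.mul hM).mul hP).mono (by omega)) ((hA'.mul (hM.mul hP)).mono (by omega))

/-- The ring of formal pseudodifferential operators. -/
@[reducible]
def psiDORing (R : Type*) [CommRing R] [Differential R] : Ring (PsiDO R) :=
  { (inferInstance : AddCommGroup (PsiDO R)), (inferInstance : Mul (PsiDO R)),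
    (inferInstance : One (PsiDO R)) with
    left_distrib := psiDO_mul_add
    right_distrib := psiDO_add_mul
    zero_mul := psiDO_zero_mul
    mul_zero := psiDO_mul_zero
    mul_assoc := psiDO_mul_assoc
    one_mul := psiDO_one_mul
    mul_one := psiDO_mul_one
    zsmul := (inferInstance : AddCommGroup (PsiDO R)).zsmul
    zsmul_zero' := SubNegMonoid.zsmul_zero'
    zsmul_succ' := SubNegMonoid.zsmul_succ'
    zsmul_neg' := SubNegMonoid.zsmul_neg' }

end PsiDORing

/-! ### Inverses of monic operators, differential parts and residues. -/

section PsiDOInverse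

variable {R : Type*} [CommRing R] [Differential R]

attribute [local instance] psiDORing

theorem ordLE_one : OrdLE (1 : PsiDO R) 0 := ordLE_mono 1 0

theorem OrdLE.pow {K : PsiDO R} (hK : OrdLE K (-1)) (p : ℕ) : OrdLE (K ^ p) (-p) := by
  induction p with
  | zero => simpa using ordLE_one
  | succ p ih =>
    rw [pow_succ]
    exact (ih.mul hK).mono (by push_cast; omega)

theorem sum_coeff {ι : Type*} (s : Finset ι) (A : ι → PsiDO R) (m : ℤ) :
    (∑ i ∈ s, A i).1 m = ∑ i ∈ s, (A i).1 m := by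
  rw [AddSubgroup.val_finsetSum, Finset.sum_apply]

/-- The geometric series. -/
theorem exists_inverse_one_sub {K : PsiDO R} (hK : OrdLE K (-1)) :
    ∃ G, (1 - K) * G = 1 ∧ G * (1 - K) = 1 := by
  -- As `K ^ p` has order at most `-p`, only the powers with `p ≤ -m` reach `∂^m`, so each
  -- coefficient of the series is a finite sum.
  let G : PsiDO R := ⟨fun m => ∑ p ∈ Finset.range ((-m).toNat + 1), (K ^ p).1 m, 0, fun m hm => by
    refine Finset.sum_eq_zero fun p _ => hK.pow p m (by omega)⟩
  have hG : ∀ P : ℕ, 1 ≤ P → OrdLE (G - ∑ p ∈ Finset.range P, K ^ p) (-P) := by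
    intro P hP m hm
    change (∑ p ∈ Finset.range ((-m).toNat + 1), (K ^ p).1 m) - (∑ p ∈ Finset.range P, K ^ p).1 m = 0
    rw [sum_coeff, sub_eq_zero]
    refine Finset.sum_subset (fun p hp => ?_) fun p _ hp => hK.pow p m ?_
    · simp only [Finset.mem_range] at hp ⊢
      omega
    · simp only [Finset.mem_range] at hp
      omega
  have h1K : OrdLE (1 - K) 0 := ordLE_one.sub (hK.mono (by omega))
  have hN : ∀ N : ℤ, ∃ P : ℕ, 1 ≤ P ∧ -(P : ℤ) ≤ N := fun N => ⟨(-N).toNat + 1, by omega, by omega⟩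
  refine ⟨G, sub_eq_zero.1 (eq_zero_of_ordLE fun N => ?_),
    sub_eq_zero.1 (eq_zero_of_ordLE fun N => ?_)⟩ <;> obtain ⟨P, hP, hPN⟩ := hN N
  · have : (1 - K) * G - 1 = (1 - K) * (G - ∑ p ∈ Finset.range P, K ^ p) - K ^ P := by
      rw [mul_sub, mul_neg_geom_sum]
      abel
    rw [this]
    exact OrdLE.mono (((h1K.mul (hG P hP)).mono (by omega)).sub (hK.pow P)) hPN
  · have : G * (1 - K) - 1 = (G - ∑ p ∈ Finset.range P, K ^ p) * (1 - K) - K ^ P := by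
      rw [sub_mul, geom_sum_mul_neg]
      abel
    rw [this]
    exact OrdLE.mono ((((hG P hP).mul h1K).mono (by omega)).sub (hK.pow P)) hPN

theorem mono_one_mul_mono_one (i j : ℤ) : (mono 1 i * mono 1 j : PsiDO R) = mono 1 (i + j) :=
  mono_mul_one_mono 1 i j

/-- A monic operator of order `N` has an inverse of order `-N`. -/
theorem exists_inverse_of_monic {L : PsiDO R} {N : ℤ} (hL : OrdLE (mono 1 N - L) (N - 1)) :
    ∃ M, IsInverse L M ∧ OrdLE M (-N) := by
  have hK : OrdLE ((mono 1 N - L) * mono 1 (-N)) (-1) :=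
    (hL.mul (ordLE_mono 1 (-N))).mono (by omega)
  obtain ⟨G, hG1, hG2⟩ := exists_inverse_one_sub hK
  have e1 : (mono 1 N * mono 1 (-N) : PsiDO R) = 1 := by
    rw [mono_one_mul_mono_one, add_neg_cancel]; rfl
  have e2 : (mono 1 (-N) * mono 1 N : PsiDO R) = 1 := by
    rw [mono_one_mul_mono_one, neg_add_cancel]; rfl
  have hLK : 1 - (mono 1 N - L) * mono 1 (-N) = L * mono 1 (-N) := by
    rw [sub_mul, e1]
    abel
  rw [hLK] at hG1 hG2
  have hM : IsInverse L (mono 1 (-N) * G) := by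
    refine ⟨by rw [← mul_assoc, hG1], ?_⟩
    calc mono 1 (-N) * G * L = mono 1 (-N) * (G * (L * mono 1 (-N))) * mono 1 N := by
          simp only [mul_assoc, e2, mul_one]
      _ = 1 := by rw [hG2, mul_one, e2]
  refine ⟨_, hM, ?_⟩
  -- The inverse `M` satisfies `M = ∂^{-N} + ∂^{-N} (∂^N - L) M`; each substitution lowers a bound
  -- on its order by one until `-N` is reached.
  have key : ∀ k : ℕ, ∀ P : ℤ, OrdLE (mono 1 (-N) * G) P → OrdLE (mono 1 (-N) * G)
      (max (-N) (P - k)) := by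
    intro k
    induction k with
    | zero => exact fun P hP => hP.mono (by simp)
    | succ k ih =>
      intro P hP
      have : mono 1 (-N) * G = mono 1 (-N) + mono 1 (-N) * ((mono 1 N - L) * (mono 1 (-N) * G)) := by
        rw [sub_mul, hM.1, mul_sub, ← mul_assoc _ (mono 1 N), e2]
        simp
      have h := ((ordLE_mono (1 : R) (-N)).mul (hL.mul (ih P hP)))
      rw [this]
      exact ((ordLE_mono 1 (-N)).mono (le_max_left _ _)).add
        (h.mono (by push_cast; omega))
  obtain ⟨P, hP⟩ := exists_ordLE (mono 1 (-N) * G)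
  exact (key (P + N).toNat P hP).mono (by omega)

theorem IsInverse.unique {L M M' : PsiDO R} (h : IsInverse L M) (h' : IsInverse L M') : M' = M := by
  calc M' = M' * (L * M) := by rw [h.1, mul_one]
    _ = M := by rw [← mul_assoc, h'.2, one_mul]

/-! ### Differential parts -/

theorem plus_add (A B : PsiDO R) : plus (A + B) = plus A + plus B := by
  refine Subtype.ext (funext fun i => ?_)
  change (if 0 ≤ i then A.1 i + B.1 i else 0) = (if 0 ≤ i then A.1 i else 0) + if 0 ≤ i then B.1 i else 0
  split_ifs <;> simp

/-- `plus` as an additive map. -/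
def plusHom : PsiDO R →+ PsiDO R := AddMonoidHom.mk' plus plus_add

theorem plus_sub (A B : PsiDO R) : plus (A - B) = plus A - plus B := map_sub plusHom A B

theorem plus_neg (A : PsiDO R) : plus (-A) = -plus A := map_neg plusHom A

theorem plus_sum {ι : Type*} (s : Finset ι) (A : ι → PsiDO R) :
    plus (∑ i ∈ s, A i) = ∑ i ∈ s, plus (A i) := map_sum plusHom A s

theorem plus_eq_zero {A : PsiDO R} (h : OrdLE A (-1)) : plus A = 0 := by
  refine Subtype.ext (funext fun i => ?_)
  change (if 0 ≤ i then A.1 i else 0) = 0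
  split_ifs with hi
  · exact h i (by omega)
  · rfl

theorem ordLE_sub_plus (A : PsiDO R) : OrdLE (A - plus A) (-1) := fun i hi => by
  change A.1 i - (if 0 ≤ i then A.1 i else 0) = 0
  rw [if_pos (by omega), sub_self]

theorem plus_mono {f : R} {i : ℤ} (hi : 0 ≤ i) : plus (mono f i) = mono f i := by
  refine Subtype.ext (funext fun j => ?_)
  change (if 0 ≤ j then (mono f i).1 j else 0) = (mono f i).1 j
  split_ifs with hj
  · rfl
  · simp [mono, show j ≠ i by omega]

theorem plus_fun_mul (f : R) (A : PsiDO R) : plus (mono f 0 * A) = mono f 0 * plus A := by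
  refine Subtype.ext (funext fun i => ?_)
  rw [fun_mul_coeff]
  change (if 0 ≤ i then (mono f 0 * A).1 i else 0) = f * if 0 ≤ i then A.1 i else 0
  rw [fun_mul_coeff]
  split_ifs <;> simp

/-- Multiplication by `∂` moves exactly one coefficient across the cut, the residue, which lands in
order zero. -/
theorem plus_d_mul (A : PsiDO R) : plus (mono 1 1 * A) = mono 1 1 * plus A + mono (res A) 0 := by
  refine Subtype.ext (funext fun i => ?_)
  change (if 0 ≤ i then (mono 1 1 * A).1 i else 0) = (mono 1 1 * plus A).1 i + (mono (res A) 0).1 i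
  rw [d_mul_coeff, d_mul_coeff]
  change _ = ((if 0 ≤ i then A.1 i else 0)′ + if 0 ≤ i - 1 then A.1 (i - 1) else 0) + _
  rcases lt_trichotomy i 0 with h | rfl | h
  · simp [mono, h.not_ge, h.ne, show ¬ 1 ≤ i by omega]
  · simp [mono, res]
  · simp [mono, h.le, h.ne', show 1 ≤ i by omega]

theorem mono_mul_fun_coeff_neg_one (i : ℤ) (f : R) :
    (mono 1 i * mono f 0 : PsiDO R).1 (-1) = if i = -1 then f else 0 := by
  have hz : ∀ (k : ℕ) (l : ℤ), l ≠ 0 → (Differential.deriv (R := R))^[k] ((mono f 0).1 l) = 0 := by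
    intro k l hl
    simp [mono, hl]
  split_ifs with h
  · subst h
    rw [mono_mul_coeff (s := {0})]
    · simp [mono]
    · intro k hk
      rw [hz _ _ (by simp at hk; omega), mul_zero, smul_zero]
  · by_cases hi : i < -1
    · exact ((ordLE_mono 1 i).mul (ordLE_mono f 0)) (-1) (by omega)
    · obtain ⟨m, rfl⟩ := Int.eq_ofNat_of_zero_le (show 0 ≤ i by omega)
      rw [mono_mul_coeff (s := ∅), Finset.sum_empty]
      intro k _
      -- Only this order of differentiation could reach `∂^{-1}`, and its binomial coefficient `(m
      -- choose m + 1)` vanishes.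
      by_cases hk : k = m + 1
      · subst hk
        have := Ring.choose_natCast (R := ℤ) m (m + 1)
        rw [Nat.choose_succ_self] at this
        simp only [Nat.cast_zero] at this
        simp [this]
      · rw [hz _ _ (by omega), mul_zero, smul_zero]

end PsiDOInverse

/-! ## Operators attached to row and column vectors -/

section RowOperators

variable {R : Type*} [CommRing R] [Differential R] {n : ℕ}

attribute [local instance] psiDORing

/-- The operator `∑ y_j ∂^j`. -/
def rowOp (y : Fin (n + 1) → R) : PsiDO R := ∑ j, mono (y j) (j.val : ℤ)

/-- The operator `-∑ ∂^{-j-1} c_j`. -/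
def colOp (c : Fin (n + 1) → R) : PsiDO R :=
  -∑ j : Fin (n + 1), mono 1 (-(j.val : ℤ) - 1) * mono (c j) 0

/-- The covariant derivative `y' + y M` of row vectors. -/
def cov (M : Matrix (Fin (n + 1)) (Fin (n + 1)) R) (y : Fin (n + 1) → R) : Fin (n + 1) → R :=
  fun j => (y j)′ + Matrix.vecMul y M j

theorem mono_add (f g : R) (i : ℤ) : mono (f + g) i = mono f i + mono g i := by
  refine Subtype.ext (funext fun j => ?_)
  change (Pi.single i (f + g) : ℤ → R) j = (Pi.single i f : ℤ → R) j + (Pi.single i g : ℤ → R) j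
  rw [Pi.single_add]
  rfl

theorem mono_zero (i : ℤ) : mono (0 : R) i = 0 :=
  Subtype.ext (by simp [mono])

theorem mono_neg (f : R) (i : ℤ) : mono (-f) i = -mono f i := by
  refine eq_neg_of_add_eq_zero_left ?_
  rw [← mono_add, neg_add_cancel, mono_zero]

theorem fun_mul_mono (f g : R) (i : ℤ) : mono f 0 * mono g i = mono (f * g) i := by
  refine Subtype.ext (funext fun j => ?_)
  rw [fun_mul_coeff]
  by_cases h : j = i
  · subst h; simp [mono]
  · simp [mono, h]

theorem rowOp_add (y z : Fin (n + 1) → R) : rowOp (y + z) = rowOp y + rowOp z := by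
  simp only [rowOp, Pi.add_apply, mono_add, Finset.sum_add_distrib]

theorem rowOp_smul (f : R) (y : Fin (n + 1) → R) : rowOp (f • y) = mono f 0 * rowOp y := by
  simp only [rowOp, Pi.smul_apply, smul_eq_mul, ← fun_mul_mono, Finset.mul_sum]

theorem rowOp_sum {ι : Type*} (s : Finset ι) (y : ι → Fin (n + 1) → R) :
    rowOp (∑ i ∈ s, y i) = ∑ i ∈ s, rowOp (y i) :=
  map_sum (AddMonoidHom.mk' (rowOp : (Fin (n + 1) → R) → PsiDO R) rowOp_add) y s

theorem rowOp_single (j : Fin (n + 1)) : rowOp (Pi.single j 1 : Fin (n + 1) → R) = mono 1 j.val := by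
  rw [rowOp, Finset.sum_eq_single j]
  · simp
  · intro i _ hi
    simp [hi, mono_zero]
  · simp

theorem ordLE_rowOp (y : Fin (n + 1) → R) : OrdLE (rowOp y) n :=
  OrdLE.sum fun j _ => (ordLE_mono _ _).mono (by omega)

theorem plus_rowOp (y : Fin (n + 1) → R) : plus (rowOp y) = rowOp y := by
  simp only [rowOp, plus_sum]
  exact Finset.sum_congr rfl fun j _ => plus_mono (by omega)

theorem ordLE_colOp (c : Fin (n + 1) → R) : OrdLE (colOp c) (-1) :=
  (OrdLE.sum fun j _ => ((ordLE_mono _ _).mul (ordLE_mono _ _)).mono (by omega)).neg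

theorem d_mul_fun (f : R) (i : ℤ) : mono 1 1 * mono f i = mono f′ i + mono f (i + 1) := by
  refine Subtype.ext (funext fun m => ?_)
  rw [d_mul_coeff]
  change _ = (mono f′ i).1 m + (mono f (i + 1)).1 m
  by_cases h : m = i
  · subst h; simp [mono]
  · by_cases h' : m = i + 1
    · subst h'; simp [mono]
    · simp [mono, h, h', show m - 1 ≠ i by omega]

variable {M : Matrix (Fin (n + 1)) (Fin (n + 1)) R}

/-- The first `n` rows of `M` shift basis rows just as `∂` shifts powers. The one mismatch is the
top term `y_n ∂^{n+1}`, and reducing it modulo the monic operator reproduces the contribution of the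
last row of `M`. -/
theorem d_mul_rowOp (hM : ∀ i : Fin n, M i.castSucc = Pi.single i.succ 1) (y : Fin (n + 1) → R) :
    mono 1 1 * rowOp y = rowOp (cov M y) +
      mono (y (Fin.last n)) 0 * (mono 1 ((n : ℤ) + 1) - rowOp (M (Fin.last n))) := by
  have h : cov M y = (fun j => (y j)′) + (∑ i : Fin n, y i.castSucc • M i.castSucc +
      y (Fin.last n) • M (Fin.last n)) := by
    funext j
    simp only [cov, Pi.add_apply, Finset.sum_apply, Pi.smul_apply, Matrix.vecMul, dotProduct,
      smul_eq_mul, Fin.sum_univ_castSucc]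
  rw [h, rowOp_add, rowOp_add, rowOp_sum, rowOp_smul]
  simp only [rowOp_smul, hM, rowOp_single, fun_mul_mono, mul_one, mul_sub]
  have e : mono 1 1 * rowOp y =
      rowOp (fun j => (y j)′) + ∑ j : Fin (n + 1), mono (y j) ((j.val : ℤ) + 1) := by
    simp only [rowOp, Finset.mul_sum, d_mul_fun, Finset.sum_add_distrib]
  rw [e, Fin.sum_univ_castSucc]
  simp only [Fin.val_castSucc, Fin.val_last, Fin.val_succ, Nat.cast_add, Nat.cast_one]
  abel

theorem res_mono_mul_colOp (c : Fin (n + 1) → R) (k : Fin (n + 1)) :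
    res (mono 1 (k.val : ℤ) * colOp c) = -c k := by
  rw [colOp, mul_neg, Finset.mul_sum]
  change -(∑ j : Fin (n + 1), mono 1 (k.val : ℤ) * (mono 1 (-(j.val : ℤ) - 1) * mono (c j) 0) :
    PsiDO R).1 (-1) = _
  rw [sum_coeff]
  simp only [← mul_assoc, mono_one_mul_mono_one, mono_mul_fun_coeff_neg_one]
  rw [Finset.sum_eq_single k]
  · rw [if_pos (by ring)]
  · intro j _ hj
    rw [if_neg fun h => hj (Fin.ext (by omega))]
  · simp

variable {y : ℕ → Fin (n + 1) → R} {c : Fin (n + 1) → R}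

/-- Each covariant derivative subtracts the last entry `c_k` times the monic operator, and `-c_k` is
precisely the residue that `(∂^{k+1} X)₊` has in excess of `∂ (∂^k X)₊`. The quotients therefore
assemble into one operator `X` independent of `k`. -/
theorem rowOp_iterate (hM : ∀ i : Fin n, M i.castSucc = Pi.single i.succ 1)
    (hy : ∀ k, y (k + 1) = cov M (y k)) (hc : ∀ k : Fin (n + 1), y k (Fin.last n) = c k)
    (k : ℕ) (hk : k ≤ n + 1) :
    rowOp (y k) = mono 1 (k : ℤ) * rowOp (y 0) + plus (mono 1 (k : ℤ) * colOp c) *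
      (mono 1 ((n : ℤ) + 1) - rowOp (M (Fin.last n))) := by
  induction k with
  | zero =>
    have h1 : (mono 1 ((0 : ℕ) : ℤ) : PsiDO R) = 1 := rfl
    rw [h1, one_mul, one_mul, plus_eq_zero (ordLE_colOp c), zero_mul, add_zero]
  | succ k ih =>
    have h1 : (mono 1 ((k + 1 : ℕ) : ℤ) : PsiDO R) = mono 1 1 * mono 1 (k : ℤ) := by
      rw [mono_one_mul_mono_one]
      push_cast
      rw [add_comm]
    rw [hy, h1, mul_assoc, mul_assoc, plus_d_mul, res_mono_mul_colOp c ⟨k, by omega⟩, ← hc, mono_neg]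
    have h2 := d_mul_rowOp hM (y k)
    rw [ih (by omega)] at h2
    rw [eq_sub_of_add_eq h2.symm]
    simp only [mul_add, add_mul, mul_assoc, neg_mul]
    abel

/-- The exponents become `n - j ≥ 0`, so the product is already a differential operator. -/
theorem mono_mul_colOp_plus (c : Fin (n + 1) → R) :
    plus (mono 1 ((n + 1 : ℕ) : ℤ) * colOp c) = mono 1 ((n + 1 : ℕ) : ℤ) * colOp c := by
  have hd : ∀ (k : ℕ) (f : R), plus (mono 1 (k : ℤ) * mono f 0) = mono 1 (k : ℤ) * mono f 0 := by
    intro k f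
    induction k with
    | zero =>
      rw [show (mono 1 ((0 : ℕ) : ℤ) : PsiDO R) = 1 from rfl, one_mul]
      exact plus_mono le_rfl
    | succ k ih =>
      have h1 : (mono 1 ((k + 1 : ℕ) : ℤ) : PsiDO R) = mono 1 1 * mono 1 (k : ℤ) := by
        rw [mono_one_mul_mono_one]
        push_cast
        rw [add_comm]
      have : res (mono 1 (k : ℤ) * mono f 0) = 0 := by
        rw [res, mono_mul_fun_coeff_neg_one, if_neg (by omega)]
      rw [h1, mul_assoc, plus_d_mul, ih, this, mono_zero, add_zero]
  rw [colOp, mul_neg, plus_neg, Finset.mul_sum, plus_sum]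
  refine congrArg _ (Finset.sum_congr rfl fun j _ => ?_)
  rw [← mul_assoc, mono_one_mul_mono_one]
  have : ((n + 1 : ℕ) : ℤ) + (-(j.val : ℤ) - 1) = ((n - j.val : ℕ) : ℤ) := by
    have := j.isLt
    omega
  rw [this, hd]

/-- At `k = n + 1` the projection in `rowOp_iterate` may be dropped and `∂^{n+1}` cancelled. What
remains is `∂^{-n-1}` times an operator of order at most `n`, which has no differential part. -/
theorem neg_rowOp_eq_plus (hM : ∀ i : Fin n, M i.castSucc = Pi.single i.succ 1)
    (hy : ∀ k, y (k + 1) = cov M (y k)) (hc : ∀ k : Fin (n + 1), y k (Fin.last n) = c k) :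
    -rowOp (y 0) = plus (colOp c * (mono 1 ((n : ℤ) + 1) - rowOp (M (Fin.last n)))) := by
  have h := rowOp_iterate hM hy hc (n + 1) le_rfl
  rw [mono_mul_colOp_plus, mul_assoc, ← mul_add] at h
  have h2 := congrArg (mono 1 (-((n + 1 : ℕ) : ℤ)) * ·) h
  simp only [← mul_assoc, mono_one_mul_mono_one, neg_add_cancel] at h2
  rw [show (mono 1 0 : PsiDO R) = 1 from rfl, one_mul] at h2
  rw [← sub_eq_of_eq_add' h2, plus_sub, plus_rowOp, plus_eq_zero, zero_sub]
  exact ((ordLE_mono _ _).mul (ordLE_rowOp _)).mono (by push_cast; omega)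

/-- Both `y (n + 1)` and the combination of rows dictated by the last row of `M` are expanded by
`rowOp_iterate`; their difference assembles the full monic operator on both sides. -/
theorem neg_rowOp_eq (hM : ∀ i : Fin n, M i.castSucc = Pi.single i.succ 1)
    (hy : ∀ k, y (k + 1) = cov M (y k)) (hc : ∀ k : Fin (n + 1), y k (Fin.last n) = c k)
    {w : Fin (n + 1) → R} (hw : y (n + 1) = w + ∑ k : Fin (n + 1), M (Fin.last n) k • y k) :
    -rowOp w = (mono 1 ((n : ℤ) + 1) - rowOp (M (Fin.last n))) * -rowOp (y 0) -
      plus ((mono 1 ((n : ℤ) + 1) - rowOp (M (Fin.last n))) * colOp c) *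
        (mono 1 ((n : ℤ) + 1) - rowOp (M (Fin.last n))) := by
  set L := mono 1 ((n : ℤ) + 1) - rowOp (M (Fin.last n)) with hL
  have h1 := congrArg rowOp hw
  rw [rowOp_add, rowOp_sum, rowOp_iterate hM hy hc (n + 1) le_rfl] at h1
  have h2 : ∑ k : Fin (n + 1), rowOp (M (Fin.last n) k • y k) =
      rowOp (M (Fin.last n)) * rowOp (y 0) + plus (rowOp (M (Fin.last n)) * colOp c) * L := by
    have e : ∀ k : Fin (n + 1), mono (M (Fin.last n) k) (k.val : ℤ) =
        mono (M (Fin.last n) k) 0 * mono 1 (k.val : ℤ) := fun k => by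
      rw [fun_mul_mono, mul_one]
    conv_rhs => rw [show rowOp (M (Fin.last n)) = _ from Finset.sum_congr rfl fun k _ => e k]
    simp only [Finset.sum_mul, plus_sum, ← Finset.sum_add_distrib]
    refine Finset.sum_congr rfl fun k _ => ?_
    rw [rowOp_smul, rowOp_iterate hM hy hc k (by omega), mul_assoc, mul_assoc, plus_fun_mul,
      mul_add, mul_assoc]
  have h3 : rowOp w = L * rowOp (y 0) + plus (L * colOp c) * L := by
    rw [h2] at h1
    rw [eq_sub_of_add_eq h1.symm]
    conv_rhs => rw [hL]
    rw [sub_mul, sub_mul, plus_sub, sub_mul]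
    push_cast
    abel
  rw [h3]
  simp only [mul_neg]
  abel

end RowOperators

/-! ## Integration over the circle -/

section LoopIntegral

variable {𝕜 : Type*} [RCLike 𝕜]

theorem continuous_loop (f : Loop 𝕜) : Continuous f.1 := f.2.1.continuous

theorem loop_deriv_val (f : Loop 𝕜) : (f′).1 = deriv f.1 := rfl

theorem loop_deriv_smul (c : 𝕜) (f : Loop 𝕜) : (c • f)′ = c • f′ :=
  Subtype.ext (funext fun x => deriv_const_smul c (differentiable_loop f x))

theorem loopIntegral_add (f g : Loop 𝕜) :
    loopIntegral (f + g) = loopIntegral f + loopIntegral g :=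
  intervalIntegral.integral_add ((continuous_loop f).intervalIntegrable _ _)
    ((continuous_loop g).intervalIntegrable _ _)

/-- `loopIntegral` as an additive map. -/
def loopIntegralHom : Loop 𝕜 →+ 𝕜 := AddMonoidHom.mk' loopIntegral loopIntegral_add

theorem loopIntegral_zero : loopIntegral (0 : Loop 𝕜) = 0 := map_zero loopIntegralHom

theorem loopIntegral_sub (f g : Loop 𝕜) :
    loopIntegral (f - g) = loopIntegral f - loopIntegral g := map_sub loopIntegralHom f g

theorem loopIntegral_sum {ι : Type*} (s : Finset ι) (f : ι → Loop 𝕜) :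
    loopIntegral (∑ i ∈ s, f i) = ∑ i ∈ s, loopIntegral (f i) := map_sum loopIntegralHom f s

theorem loopIntegral_smul_intCast (c : ℤ) (f : Loop 𝕜) :
    loopIntegral (c • f) = c • loopIntegral f := map_zsmul loopIntegralHom c f

theorem loopIntegral_deriv (f : Loop 𝕜) : loopIntegral f′ = 0 := by
  have h : ∫ x in (0 : ℝ)..(2 * Real.pi), deriv f.1 x = f.1 (2 * Real.pi) - f.1 0 :=
    intervalIntegral.integral_deriv_eq_sub (fun x _ => differentiable_loop f x)
      ((continuous_loop f′).intervalIntegrable _ _)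
  have hp : f.1 (2 * Real.pi) = f.1 0 := by simpa using f.2.2 0
  rw [loopIntegral, loop_deriv_val, h, hp, sub_self]

theorem loopIntegral_iterate_deriv (f : Loop 𝕜) (k : ℕ) :
    loopIntegral ((Differential.deriv (R := Loop 𝕜))^[k + 1] f) = 0 := by
  rw [Function.iterate_succ_apply']
  exact loopIntegral_deriv _

/-- The complex conjugate of a loop. -/
def loopConj (f : Loop 𝕜) : Loop 𝕜 :=
  ⟨fun x => (starRingEnd 𝕜) (f.1 x), (RCLike.conjCLE (K := 𝕜)).contDiff.comp f.2.1,
    f.2.2.comp (starRingEnd 𝕜)⟩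

/-- Testing against the complex conjugate gives the integral of the continuous function `‖f‖²` over
one period. -/
theorem eq_zero_of_forall_loopIntegral {f : Loop 𝕜} (h : ∀ g, loopIntegral (g * f) = 0) : f = 0 := by
  have h1 : ∫ x in (0 : ℝ)..(2 * Real.pi), ‖f.1 x‖ ^ 2 = 0 := by
    have h2 : ∫ x in (0 : ℝ)..(2 * Real.pi), ((‖f.1 x‖ ^ 2 : ℝ) : 𝕜) = 0 := by
      refine Eq.trans ?_ (h (loopConj f))
      refine intervalIntegral.integral_congr fun x _ => ?_
      change _ = (starRingEnd 𝕜) (f.1 x) * f.1 x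
      rw [RCLike.conj_mul, RCLike.ofReal_pow]
    rw [intervalIntegral.integral_of_le Real.two_pi_pos.le, integral_ofReal] at h2
    rw [intervalIntegral.integral_of_le Real.two_pi_pos.le]
    exact RCLike.ofReal_eq_zero.1 h2
  have hc : Continuous fun x => ‖f.1 x‖ ^ 2 := (continuous_loop f).norm.pow 2
  have hz : ∀ x ∈ Set.Icc (0 : ℝ) (2 * Real.pi), f.1 x = 0 := by
    intro x hx
    by_contra hne
    refine (intervalIntegral.integral_pos Real.two_pi_pos hc.continuousOn
      (fun y _ => by positivity) ⟨x, hx, ?_⟩).ne' h1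
    positivity
  refine Subtype.ext (funext fun x => ?_)
  obtain ⟨y, hy, hxy⟩ := f.2.2.exists_mem_Ico₀ Real.two_pi_pos x
  rw [hxy, hz y ⟨hy.1, hy.2.le⟩]
  rfl

/-- The residue is a multiple of the derivative of `f` of order `j - a`. It is zero for `j < a`, a
total derivative for `j > a`, and `f` itself for `j = a`. -/
theorem res_mono_mul_mono (a j : ℕ) (f : Loop 𝕜) :
    adlerTrace (mono 1 (-(a : ℤ) - 1) * mono f (j : ℤ)) = if a = j then loopIntegral f else 0 := by
  have hz : ∀ (k : ℕ) (l : ℤ), l ≠ j →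
      (Differential.deriv (R := Loop 𝕜))^[k] ((mono f (j : ℤ)).1 l) = 0 := by
    intro k l hl
    simp [mono, hl]
  rw [adlerTrace, res]
  by_cases haj : a ≤ j
  · rw [mono_mul_coeff (s := {j - a})]
    · rw [Finset.sum_singleton, loopIntegral_smul_intCast, one_mul,
        show -1 - (-(a : ℤ) - 1) + ((j - a : ℕ) : ℤ) = j by omega]
      have : (mono f (j : ℤ)).1 (j : ℤ) = f := by simp [mono]
      rw [this]
      split_ifs with h
      · subst h
        simp
      · obtain ⟨k, hk⟩ := Nat.exists_eq_succ_of_ne_zero (show j - a ≠ 0 by omega)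
        rw [hk, Nat.succ_eq_add_one, loopIntegral_iterate_deriv, smul_zero]
    · intro k hk
      rw [hz _ _ (by simp at hk; omega), mul_zero, smul_zero]
  · rw [mono_mul_coeff (s := ∅), if_neg (by omega), Finset.sum_empty, loopIntegral_zero]
    intro k _
    rw [hz _ _ (by omega), mul_zero, smul_zero]

end LoopIntegral

/-! ## Curves of loops -/

section LoopCurves

variable (𝕜 : Type*) [RCLike 𝕜]

/-- Smooth curves in the space of loops. -/
def loopCurve : Subring (ℝ → Loop 𝕜) where
  carrier := {F | ContDiff ℝ ∞ fun p : ℝ × ℝ => (F p.1).1 p.2}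
  mul_mem' := fun {F G} hF hG => by
    change ContDiff ℝ ∞ fun p : ℝ × ℝ => (F p.1).1 p.2 * (G p.1).1 p.2
    exact ContDiff.mul hF hG
  add_mem' := fun {F G} hF hG => by
    change ContDiff ℝ ∞ fun p : ℝ × ℝ => (F p.1).1 p.2 + (G p.1).1 p.2
    exact ContDiff.add hF hG
  neg_mem' := fun {F} hF => by
    change ContDiff ℝ ∞ fun p : ℝ × ℝ => -(F p.1).1 p.2
    exact ContDiff.neg hF
  zero_mem' := by
    change ContDiff ℝ ∞ fun _ : ℝ × ℝ => (0 : 𝕜)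
    exact contDiff_const
  one_mem' := by
    change ContDiff ℝ ∞ fun _ : ℝ × ℝ => (1 : 𝕜)
    exact contDiff_const

/-- The ring of smooth curves in the space of loops. -/
abbrev LoopCurve : Type _ := ↥(loopCurve 𝕜)

variable {𝕜}

theorem hasDerivAt_time {G : ℝ × ℝ → 𝕜} (hG : ContDiff ℝ ∞ G) (t x : ℝ) :
    HasDerivAt (fun s => G (s, x)) (fderiv ℝ G (t, x) (1, 0)) t :=
  (hG.differentiable (by simp) (t, x)).hasFDerivAt.comp_hasDerivAt t
    ((hasDerivAt_id t).prodMk (hasDerivAt_const t x))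

theorem hasDerivAt_space {G : ℝ × ℝ → 𝕜} (hG : ContDiff ℝ ∞ G) (t x : ℝ) :
    HasDerivAt (fun y => G (t, y)) (fderiv ℝ G (t, x) (0, 1)) x :=
  (hG.differentiable (by simp) (t, x)).hasFDerivAt.comp_hasDerivAt x
    ((hasDerivAt_const x t).prodMk (hasDerivAt_id x))

theorem contDiff_fderiv_apply {G : ℝ × ℝ → 𝕜} (hG : ContDiff ℝ ∞ G) (v : ℝ × ℝ) :
    ContDiff ℝ ∞ fun p => fderiv ℝ G p v :=
  (hG.fderiv_right (m := ∞) (by simp)).clm_apply contDiff_const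

theorem fderiv_fderiv_apply_comm {G : ℝ × ℝ → 𝕜} (hG : ContDiff ℝ ∞ G) (p v w : ℝ × ℝ) :
    fderiv ℝ (fun q => fderiv ℝ G q v) p w = fderiv ℝ (fun q => fderiv ℝ G q w) p v := by
  have hd : DifferentiableAt ℝ (fderiv ℝ G) p :=
    (hG.fderiv_right (m := ∞) (by simp)).differentiable (by simp) p
  have h : ∀ v w, fderiv ℝ (fun q => fderiv ℝ G q v) p w = fderiv ℝ (fderiv ℝ G) p w v := by
    intro v w
    rw [fderiv_clm_apply hd (differentiableAt_const v)]
    simp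
  have h2 : minSmoothness ℝ 2 ≤ (∞ : WithTop ℕ∞) := by
    rw [minSmoothness_of_isRCLikeNormedField]
    exact WithTop.coe_le_coe.2 le_top
  rw [h, h]
  exact (hG.contDiffAt.isSymmSndFDerivAt h2) w v

theorem loopCurve_space_deriv (F : LoopCurve 𝕜) (t x : ℝ) :
    ((F.1 t)′).1 x = fderiv ℝ (fun p : ℝ × ℝ => (F.1 p.1).1 p.2) (t, x) (0, 1) :=
  (hasDerivAt_space F.2 t x).deriv

/-- The derivation is in the loop variable, not in time. Curves then form a differential ring whose
evaluations are differential homomorphisms, so algebraic constructions on matrices apply to whole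
curves at once. -/
instance : Differential (LoopCurve 𝕜) where
  deriv := Derivation.mk'
    (AddMonoidHom.toIntLinearMap
      { toFun := fun F => (⟨fun t => (F.1 t)′, by
          change ContDiff ℝ ∞ fun p : ℝ × ℝ => ((F.1 p.1)′).1 p.2
          simp only [loopCurve_space_deriv]
          exact contDiff_fderiv_apply F.2 (0, 1)⟩ : LoopCurve 𝕜)
        map_zero' := Subtype.ext (funext fun t => by
          change (0 : Loop 𝕜)′ = 0
          rw [map_zero])
        map_add' := fun F G => Subtype.ext (funext fun t => by
          change (F.1 t + G.1 t)′ = (F.1 t)′ + ((G.1 t)′)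
          rw [map_add]) })
    (fun F G => Subtype.ext (funext fun t => by
      change (F.1 t * G.1 t)′ = F.1 t * (G.1 t)′ + (G.1 t * (F.1 t)′)
      rw [Derivation.leibniz, smul_eq_mul, smul_eq_mul]))

variable (𝕜) in
/-- The value of a curve at time `t`. -/
def evalAt (t : ℝ) : LoopCurve 𝕜 →+* Loop 𝕜 := (Pi.evalRingHom _ t).comp (loopCurve 𝕜).subtype

theorem evalAt_deriv (t : ℝ) (F : LoopCurve 𝕜) : evalAt 𝕜 t F′ = (evalAt 𝕜 t F)′ := rfl

theorem loopCurve_ext {F G : LoopCurve 𝕜} (h : ∀ t, evalAt 𝕜 t F = evalAt 𝕜 t G) : F = G :=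
  Subtype.ext (funext h)

/-- The velocity of a curve at time `t`. -/
def velocity (t : ℝ) (F : LoopCurve 𝕜) : Loop 𝕜 :=
  ⟨fun x => fderiv ℝ (fun p : ℝ × ℝ => (F.1 p.1).1 p.2) (t, x) (1, 0),
    (contDiff_fderiv_apply F.2 (1, 0)).comp (contDiff_const.prodMk contDiff_id), fun x => by
      refine (hasDerivAt_time F.2 t _).unique ((hasDerivAt_time F.2 t x).congr_of_eventuallyEq ?_)
      exact Filter.Eventually.of_forall fun s => (F.1 s).2.2 x⟩

theorem hasDerivAt_velocity (F : LoopCurve 𝕜) (t x : ℝ) :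
    HasDerivAt (fun s => (evalAt 𝕜 s F).1 x) ((velocity t F).1 x) t := hasDerivAt_time F.2 t x

theorem velocity_eq {F : LoopCurve 𝕜} {t : ℝ} {g : Loop 𝕜}
    (h : ∀ x, HasDerivAt (fun s => (evalAt 𝕜 s F).1 x) (g.1 x) t) : velocity t F = g :=
  Subtype.ext (funext fun x => (hasDerivAt_velocity F t x).unique (h x))

theorem velocity_add (t : ℝ) (F G : LoopCurve 𝕜) :
    velocity t (F + G) = velocity t F + velocity t G :=
  velocity_eq fun x => (hasDerivAt_velocity F t x).add (hasDerivAt_velocity G t x)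

theorem velocity_mul (t : ℝ) (F G : LoopCurve 𝕜) :
    velocity t (F * G) = velocity t F * evalAt 𝕜 t G + evalAt 𝕜 t F * velocity t G :=
  velocity_eq fun x => by
    have h := HasDerivAt.mul (hasDerivAt_velocity F t x) (hasDerivAt_velocity G t x)
    exact h

/-- Symmetry of second derivatives; this is where joint smoothness in time and the loop variable is
used. -/
theorem velocity_deriv (t : ℝ) (F : LoopCurve 𝕜) : velocity t F′ = (velocity t F)′ := by
  refine Subtype.ext (funext fun x => ?_)
  have h1 : (fun p : ℝ × ℝ => ((F′).1 p.1).1 p.2) =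
      fun p => fderiv ℝ (fun p : ℝ × ℝ => (F.1 p.1).1 p.2) p (0, 1) :=
    funext fun p => loopCurve_space_deriv F p.1 p.2
  change fderiv ℝ (fun p : ℝ × ℝ => ((F′).1 p.1).1 p.2) (t, x) (1, 0) = deriv (velocity t F).1 x
  rw [h1, fderiv_fderiv_apply_comm F.2]
  exact (hasDerivAt_space (contDiff_fderiv_apply F.2 (1, 0)) t x).deriv.symm

theorem velocity_eq_zero_of_const {F : LoopCurve 𝕜} (t : ℝ) {g : Loop 𝕜}
    (h : ∀ s, evalAt 𝕜 s F = g) : velocity t F = 0 :=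
  velocity_eq fun x => by
    simp only [h]
    exact hasDerivAt_const t _

/-- The constant curve. -/
def constCurve (f : Loop 𝕜) : LoopCurve 𝕜 := ⟨fun _ => f, f.2.1.comp contDiff_snd⟩

/-- The time parameter, as a curve of constant loops. -/
def timeCurve : LoopCurve 𝕜 :=
  ⟨fun t => algebraMap 𝕜 (Loop 𝕜) (t : 𝕜), by
    change ContDiff ℝ ∞ fun p : ℝ × ℝ => (p.1 : 𝕜)
    exact (RCLike.ofRealCLM (K := 𝕜)).contDiff.comp contDiff_fst⟩

theorem evalAt_constCurve (t : ℝ) (f : Loop 𝕜) : evalAt 𝕜 t (constCurve f) = f := rfl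

theorem velocity_constCurve (t : ℝ) (f : Loop 𝕜) : velocity t (constCurve f) = 0 :=
  velocity_eq_zero_of_const t fun _ => rfl

theorem velocity_timeCurve (t : ℝ) : velocity t (timeCurve : LoopCurve 𝕜) = 1 :=
  velocity_eq fun x => by
    have := (RCLike.ofRealCLM (K := 𝕜)).hasDerivAt (x := t)
    rw [RCLike.ofRealCLM_apply, RCLike.ofReal_one] at this
    exact this

theorem eq_of_velocity_eq_zero {F : LoopCurve 𝕜} (h : ∀ t, velocity t F = 0) (s t : ℝ) :
    evalAt 𝕜 s F = evalAt 𝕜 t F := by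
  refine Subtype.ext (funext fun x => ?_)
  have hd : ∀ r, HasDerivAt (fun s => (evalAt 𝕜 s F).1 x) 0 r := fun r => by
    have := hasDerivAt_velocity F r x
    rw [h] at this
    exact this
  exact is_const_of_deriv_eq_zero (fun r => (hd r).differentiableAt) (fun r => (hd r).deriv) s t

end LoopCurves

/-! ## Triangular matrices and the frame generated by the first basis vector -/

section Frames

variable {R : Type*} [CommRing R] {n : ℕ}

/-- Strictly lower triangular matrices. -/
def StrictLower (N : Matrix (Fin (n + 1)) (Fin (n + 1)) R) : Prop := ∀ i j, i ≤ j → N i j = 0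

/-- Lower triangular matrices with ones on the diagonal. -/
def UniLower (T : Matrix (Fin (n + 1)) (Fin (n + 1)) R) : Prop := StrictLower (T - 1)

variable {N N' T : Matrix (Fin (n + 1)) (Fin (n + 1)) R}

theorem StrictLower.add (h : StrictLower N) (h' : StrictLower N') : StrictLower (N + N') :=
  fun i j hij => by simp [h i j hij, h' i j hij]

theorem StrictLower.sub (h : StrictLower N) (h' : StrictLower N') : StrictLower (N - N') :=
  fun i j hij => by simp [h i j hij, h' i j hij]

theorem strictLower_zero : StrictLower (0 : Matrix (Fin (n + 1)) (Fin (n + 1)) R) :=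
  fun _ _ _ => rfl

theorem StrictLower.trace (h : StrictLower N) : N.trace = 0 :=
  Finset.sum_eq_zero fun i _ => h i i le_rfl

theorem StrictLower.mul (h : StrictLower N) (h' : StrictLower N') : StrictLower (N * N') := by
  intro i j hij
  rw [Matrix.mul_apply]
  refine Finset.sum_eq_zero fun k _ => ?_
  rcases le_total i k with hk | hk
  · simp only [h i k hk, zero_mul]
  · simp only [h' k j (hk.trans hij), mul_zero]

theorem UniLower.mul_strictLower (hT : UniLower T) (h : StrictLower N) : StrictLower (T * N) := by
  have : T * N = (T - 1) * N + N := by rw [sub_mul, one_mul, sub_add_cancel]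
  rw [this]
  exact (StrictLower.mul hT h).add h

theorem UniLower.apply_self (hT : UniLower T) (i : Fin (n + 1)) : T i i = 1 := by
  have := hT i i le_rfl
  simpa [sub_eq_zero] using this

theorem UniLower.apply_of_lt (hT : UniLower T) {i j : Fin (n + 1)} (h : i < j) : T i j = 0 := by
  have := hT i j h.le
  simpa [sub_eq_zero, h.ne] using this

theorem UniLower.row_zero (hT : UniLower T) : T 0 = Pi.single 0 1 := by
  funext j
  rcases eq_or_ne j 0 with rfl | h
  · simp [hT.apply_self]
  · simp [hT.apply_of_lt (Fin.pos_iff_ne_zero.2 h), h]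

theorem uniLower_iff : UniLower T ↔ ∀ i j, i ≤ j → T i j = (1 : Matrix _ _ R) i j :=
  forall₃_congr fun i j _ => by rw [Matrix.sub_apply, sub_eq_zero]

theorem UniLower.det (hT : UniLower T) : T.det = 1 := by
  rw [Matrix.det_of_isLowerTriangular T fun i j h => hT.apply_of_lt h]
  simp [hT.apply_self]

/-- Downward induction on the column: in column `j` of `W T`, unitriangularity removes the terms `k
< j` and the induction hypothesis removes the terms `k > j`. -/
theorem StrictLower.of_mul {W : Matrix (Fin (n + 1)) (Fin (n + 1)) R} (h : StrictLower N)
    (hT : UniLower T) (hW : W * T = N) : StrictLower W := by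
  have key : ∀ j : Fin (n + 1), ∀ i, i ≤ j → W i j = 0 := by
    intro j
    induction j using WellFoundedGT.induction with
    | ind j ih =>
      intro i hij
      have h1 := h i j hij
      rw [← hW, Matrix.mul_apply, Finset.sum_eq_single j] at h1
      · rwa [hT.apply_self, mul_one] at h1
      · intro k _ hk
        rcases lt_or_gt_of_ne hk with hk | hk
        · rw [hT.apply_of_lt hk, mul_zero]
        · rw [ih k hk i (hij.trans hk.le), zero_mul]
      · simp
  exact fun i j => key j i

theorem UniLower.mul_inv (hT : UniLower T) : T * T⁻¹ = 1 :=
  Matrix.mul_nonsing_inv T (by rw [hT.det]; exact isUnit_one)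

theorem UniLower.inv_mul (hT : UniLower T) : T⁻¹ * T = 1 :=
  Matrix.nonsing_inv_mul T (by rw [hT.det]; exact isUnit_one)

theorem UniLower.mul_right_cancel (hT : UniLower T) {X Y : Matrix (Fin (n + 1)) (Fin (n + 1)) R}
    (h : X * T = Y * T) : X = Y := by
  rw [← mul_one X, ← hT.mul_inv, ← mul_assoc, h, mul_assoc, hT.mul_inv, mul_one]

theorem UniLower.inv_mul_cancel_right (hT : UniLower T)
    (X : Matrix (Fin (n + 1)) (Fin (n + 1)) R) : X * T⁻¹ * T = X := by
  rw [mul_assoc, hT.inv_mul, mul_one]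

theorem UniLower.adjugate_mul (hT : UniLower T) : T.adjugate * T = 1 := by
  rw [Matrix.adjugate_mul, hT.det, one_smul]

variable [Differential R]

/-- The entrywise derivative. -/
def mderiv (V : Matrix (Fin (n + 1)) (Fin (n + 1)) R) : Matrix (Fin (n + 1)) (Fin (n + 1)) R :=
  V.map (Differential.deriv (R := R))

theorem mderiv_add (V W : Matrix (Fin (n + 1)) (Fin (n + 1)) R) :
    mderiv (V + W) = mderiv V + mderiv W := by
  ext i j
  simp [mderiv]

theorem mderiv_mul (V W : Matrix (Fin (n + 1)) (Fin (n + 1)) R) :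
    mderiv (V * W) = mderiv V * W + V * mderiv W := by
  ext i j
  simp only [mderiv, Matrix.map_apply, Matrix.mul_apply, Matrix.add_apply, map_sum,
    Derivation.leibniz, smul_eq_mul, ← Finset.sum_add_distrib]
  refine Finset.sum_congr rfl fun k _ => ?_
  rw [add_comm, mul_comm (W k j)]

theorem mderiv_one : mderiv (1 : Matrix (Fin (n + 1)) (Fin (n + 1)) R) = 0 := by
  ext i j
  by_cases h : i = j <;> simp [mderiv, h]

theorem StrictLower.mderiv (h : StrictLower N) : StrictLower (mderiv N) :=
  fun i j hij => by simp [GelfandDickey.mderiv, h i j hij]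

theorem UniLower.mderiv (h : UniLower T) : StrictLower (mderiv T) := by
  have : T = (T - 1) + 1 := by simp
  rw [this, mderiv_add, mderiv_one, add_zero]
  exact StrictLower.mderiv h

variable (M S : Matrix (Fin (n + 1)) (Fin (n + 1)) R)

theorem row_mderiv_add_mul (i : Fin (n + 1)) : (mderiv T + T * M) i = cov M (T i) := rfl

/-- The iterated covariant derivatives of the first basis vector. -/
def frameRow : ℕ → Fin (n + 1) → R
  | 0 => Pi.single 0 1
  | k + 1 => cov M (frameRow k)

/-- The matrix whose rows are the first `n + 1` iterated covariant derivatives of the first basis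
vector. -/
def frame : Matrix (Fin (n + 1)) (Fin (n + 1)) R := Matrix.of fun i => frameRow M i.val

/-- The gauge transform of `M` by its frame. -/
def frob : Matrix (Fin (n + 1)) (Fin (n + 1)) R :=
  (mderiv (frame M) + frame M * M) * (frame M).adjugate

/-- The coordinates of `frob M`. -/
def invariants (j : Fin n) : R := frob M (Fin.last n) j.castSucc

/-! ### Compatibility of frames with differential ring homomorphisms. -/

section Naturality

variable {R' : Type*} [CommRing R'] [Differential R'] {φ : R →+* R'}

theorem cov_map (hφ : ∀ x, φ x′ = (φ x)′) (y : Fin (n + 1) → R) : cov (M.map φ) (φ ∘ y) = φ ∘ cov M y := by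
  funext j
  simp [cov, hφ, Matrix.vecMul, dotProduct, map_sum]

theorem mderiv_map (hφ : ∀ x, φ x′ = (φ x)′) : mderiv (M.map φ) = (mderiv M).map φ := by
  ext i j
  simp [mderiv, hφ]

theorem frameRow_map (hφ : ∀ x, φ x′ = (φ x)′) (k : ℕ) : frameRow (M.map φ) k = φ ∘ frameRow M k := by
  induction k with
  | zero =>
    funext j
    by_cases h : j = 0 <;> simp [frameRow, h]
  | succ k ih => rw [frameRow, ih, cov_map M hφ]; rfl

theorem frame_map (hφ : ∀ x, φ x′ = (φ x)′) : frame (M.map φ) = (frame M).map φ := by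
  ext i j
  exact congrFun (frameRow_map M hφ i) j

/-- The adjugate is polynomial in the entries, so it commutes with ring homomorphisms and needs no
invertibility hypothesis. -/
theorem frob_map (hφ : ∀ x, φ x′ = (φ x)′) : frob (M.map φ) = (frob M).map φ := by
  have h : (frame M).adjugate.map φ = ((frame M).map φ).adjugate := φ.map_adjugate (frame M)
  rw [frob, frob, frame_map M hφ, mderiv_map _ hφ, Matrix.map_mul,
    Matrix.map_add φ (map_add φ), Matrix.map_mul, h]

end Naturality

/-! ### Hessenberg matrices and their Frobenius normal form. -/

/-- Matrices that agree with the superdiagonal matrix outside the last row and first column. -/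
def IsHessenberg : Prop :=
  ∀ i j : Fin n, M i.castSucc j.succ = if i = j then 1 else 0

variable {M S}

theorem IsHessenberg.vecMul (hM : IsHessenberg M) (y : Fin (n + 1) → R) (j : Fin n) :
    Matrix.vecMul y M j.succ = y j.castSucc + y (Fin.last n) * M (Fin.last n) j.succ := by
  simp [Matrix.vecMul, dotProduct, Fin.sum_univ_castSucc, hM _ _]

theorem IsHessenberg.mul_apply (hM : IsHessenberg M) (V : Matrix (Fin (n + 1)) (Fin (n + 1)) R)
    (i : Fin n) (j : Fin (n + 1)) :
    (M * V) i.castSucc j = V i.succ j + M i.castSucc 0 * V 0 j := by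
  simp [Matrix.mul_apply, Fin.sum_univ_succ, hM _ _, add_comm]

/-- To leading order a covariant derivative shifts a row one place to the right; the last-row term
of `S` enters only after the leading `1` has reached the last column. -/
theorem IsHessenberg.frameRow_apply (hM : IsHessenberg M) (k : ℕ) (hk : k ≤ n) (j : Fin (n + 1))
    (hj : k ≤ j.val) : frameRow M k j = if j.val = k then 1 else 0 := by
  induction k generalizing j with
  | zero =>
    change (Pi.single 0 1 : Fin (n + 1) → R) j = _
    rw [Pi.single_apply]
    exact if_congr Fin.ext_iff rfl rfl
  | succ k ih =>
    obtain ⟨j, rfl⟩ := Fin.exists_succ_eq.2 (show j ≠ 0 by rintro rfl; simp at hj)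
    simp only [Fin.val_succ] at hj ⊢
    rw [frameRow, cov, hM.vecMul, ih (by omega) j.succ (by simp; omega),
      ih (by omega) j.castSucc (by simp; omega), ih (by omega) (Fin.last n) (by simp; omega), Fin.val_last, if_neg (show ¬ n = k by omega),
      if_neg (show ¬ (j.succ.val = k) by simp; omega)]
    simp

theorem IsHessenberg.uniLower_frame (hM : IsHessenberg M) : UniLower (frame M) := by
  refine uniLower_iff.2 fun i j hij => ?_
  rw [frame, Matrix.of_apply, hM.frameRow_apply i.val (by omega) j hij, Matrix.one_apply]
  simp [Fin.ext_iff, eq_comm]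

theorem frame_row_succ (i : Fin n) : cov M (frame M i.castSucc) = frame M i.succ := rfl

theorem IsHessenberg.frob_mul_frame (hM : IsHessenberg M) :
    frob M * frame M = mderiv (frame M) + frame M * M := by
  rw [frob, mul_assoc, hM.uniLower_frame.adjugate_mul, mul_one]

/-- The gauge transform by a lower unitriangular matrix. -/
theorem trace_gauge (hT : UniLower T) (h : S * T = mderiv T + T * M) : S.trace = M.trace := by
  have h1 : S = (mderiv T) * T⁻¹ + T * M * T⁻¹ := by
    rw [← add_mul, ← h, mul_assoc, hT.mul_inv, mul_one]
  rw [h1, Matrix.trace_add, (StrictLower.of_mul hT.mderiv hT (hT.inv_mul_cancel_right _)).trace,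
    zero_add, mul_assoc, Matrix.trace_mul_comm, mul_assoc, hT.inv_mul, mul_one]

theorem row_gauge (hT : UniLower T) (h : S * T = mderiv T + T * M) {i : Fin n} {s : R}
    (hi : cov M (T i.castSucc) = T i.succ + s • Pi.single 0 1) :
    S i.castSucc = Pi.single i.succ 1 + s • Pi.single 0 1 := by
  have h1 : Matrix.vecMul (S i.castSucc) T = Matrix.vecMul (Pi.single i.succ 1 + s • Pi.single 0 1) T := by
    have : Matrix.vecMul (S i.castSucc) T = (S * T) i.castSucc := rfl
    rw [this, h, row_mderiv_add_mul, hi, Matrix.add_vecMul, Matrix.smul_vecMul,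
      Matrix.single_one_vecMul, Matrix.single_one_vecMul]
    change _ = T i.succ + s • T 0
    rw [hT.row_zero]
  have h2 := congrArg (fun y => Matrix.vecMul y T⁻¹) h1
  simpa only [Matrix.vecMul_vecMul, hT.mul_inv, Matrix.vecMul_one] using h2

/-- The covariant derivative of row `i` of `T` need only match row `i + 1` off the first column: the
defect is a multiple of the first basis row, which is row `0` of `T` and so affects only the first
column of `S`. -/
theorem isHessenberg_gauge (hT : UniLower T) (h : S * T = mderiv T + T * M)
    (hr : ∀ i j : Fin n, cov M (T i.castSucc) j.succ = T i.succ j.succ) : IsHessenberg S := by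
  intro i j
  rw [row_gauge hT h (s := cov M (T i.castSucc) 0 - T i.succ 0)]
  · simp [Pi.single_apply, eq_comm]
  · funext j
    refine Fin.cases ?_ (fun j => ?_) j
    · simp
    · simp [hr]

theorem IsHessenberg.frob_row (hM : IsHessenberg M) (i : Fin n) :
    frob M i.castSucc = Pi.single i.succ 1 := by
  have := row_gauge hM.uniLower_frame hM.frob_mul_frame (i := i) (s := 0) (by
    rw [frame_row_succ, zero_smul, add_zero])
  simpa using this

theorem frame_of_row (hM : ∀ i : Fin n, M i.castSucc = Pi.single i.succ 1) : frame M = 1 := by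
  have key : ∀ k (hk : k < n + 1), frameRow M k = Pi.single ⟨k, hk⟩ 1 := by
    intro k
    induction k with
    | zero => exact fun _ => rfl
    | succ k ih =>
      intro hk
      rw [frameRow, ih (by omega)]
      funext j
      have : M ⟨k, by omega⟩ = Pi.single ⟨k + 1, hk⟩ 1 := hM ⟨k, by omega⟩
      simp only [cov, Matrix.single_one_vecMul, Matrix.row, this, Pi.single_apply]
      split_ifs <;> simp
  ext i j
  rw [frame, Matrix.of_apply, key i.val i.isLt, Matrix.one_apply, Pi.single_apply]
  simp [eq_comm]

theorem frob_of_row (hM : ∀ i : Fin n, M i.castSucc = Pi.single i.succ 1) : frob M = M := by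
  rw [frob, frame_of_row hM, mderiv_one, zero_add, one_mul, Matrix.adjugate_one, mul_one]

end Frames

/-! ## The Poisson tensors, the leaf and the gauge group -/

section Reduction

variable {𝕜 : Type*} [RCLike 𝕜] {n : ℕ}

theorem P₁_eq (S V : Mat 𝕜 n) : P₁ S V = mderiv V + (V * S - S * V) := rfl

theorem P₀_eq (S V : Mat 𝕜 n) : P₀ S V = matA 𝕜 n * V - V * matA 𝕜 n := rfl

theorem P₁_apply (S V : Mat 𝕜 n) (i j : Fin (n + 1)) :
    P₁ S V i j = cov S (V i) j - (S * V) i j := by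
  rw [P₁_eq, Matrix.add_apply, Matrix.sub_apply, ← add_sub_assoc]
  rfl

theorem P₀_apply (S V : Mat 𝕜 n) (i j : Fin (n + 1)) :
    P₀ S V i j = (if i = Fin.last n then V 0 j else 0) - if j = 0 then V i (Fin.last n) else 0 := by
  rw [P₀_eq, Matrix.sub_apply, matA]
  congr 1
  · split_ifs with h
    · subst h; simp
    · simp [h]
  · split_ifs with h
    · subst h; simp
    · simp [h]

theorem P₁_add (S V W : Mat 𝕜 n) : P₁ S (V + W) = P₁ S V + P₁ S W := by
  simp only [P₁_eq, mderiv_add, add_mul, mul_add]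
  abel

/-- `P₁ S` as an additive map. -/
def P₁Hom (S : Mat 𝕜 n) : Mat 𝕜 n →+ Mat 𝕜 n := AddMonoidHom.mk' (P₁ S) (P₁_add S)

theorem P₁_sub (S V W : Mat 𝕜 n) : P₁ S (V - W) = P₁ S V - P₁ S W := map_sub (P₁Hom S) V W

theorem P₁_zero (S : Mat 𝕜 n) : P₁ S 0 = 0 := map_zero (P₁Hom S)

theorem P₀_sub (S V W : Mat 𝕜 n) : P₀ S (V - W) = P₀ S V - P₀ S W := by
  simp only [P₀_eq, mul_sub, sub_mul]
  abel

theorem trace_mderiv (V : Mat 𝕜 n) : (mderiv V).trace = V.trace′ := by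
  simp [Matrix.trace, mderiv]

theorem trace_P₁ (S : Mat 𝕜 n) {V : Mat 𝕜 n} (hV : V.trace = 0) : (P₁ S V).trace = 0 := by
  rw [P₁_eq, Matrix.trace_add, Matrix.trace_sub, Matrix.trace_mul_comm V S, sub_self, add_zero,
    trace_mderiv, hV, map_zero]

theorem pencil_eq (lam : 𝕜) (S V : Mat 𝕜 n) : pencil lam S V = P₁ S V - lam • P₀ S V := by
  change mderiv V + (V * (S + lam • matA 𝕜 n) - (S + lam • matA 𝕜 n) * V) = _
  rw [P₁_eq, P₀_eq, mul_add, add_mul, Matrix.mul_smul, Matrix.smul_mul, smul_sub]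
  abel

theorem pencil_eq_P₁ (lam : 𝕜) (S V : Mat 𝕜 n) :
    pencil lam S V = P₁ (S + lam • matA 𝕜 n) V := rfl

theorem last_ne_zero (hn : 1 ≤ n) : Fin.last n ≠ 0 := by
  rw [Ne, Fin.ext_iff]
  simp
  omega

theorem exists_castSucc {i : Fin (n + 1)} (h : i ≠ Fin.last n) : ∃ k : Fin n, i = k.castSucc := by
  obtain ⟨k, hk⟩ := Fin.exists_castSucc_eq.2 h
  exact ⟨k, hk.symm⟩

theorem exists_succ {i : Fin (n + 1)} (h : i ≠ 0) : ∃ k : Fin n, i = k.succ := by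
  obtain ⟨k, hk⟩ := Fin.exists_succ_eq.2 h
  exact ⟨k, hk.symm⟩

/-- The image of `ad A` consists of the traceless matrices supported on the last row and the first
column. -/
theorem mem_tangentS (hn : 1 ≤ n) {Y : Mat 𝕜 n} :
    Y ∈ tangentS 𝕜 n ↔ (∀ i j : Fin n, Y i.castSucc j.succ = 0) ∧ Y.trace = 0 := by
  have hl := last_ne_zero hn
  constructor
  · rintro ⟨V, -, rfl⟩
    change (∀ i j : Fin n, P₀ V V i.castSucc j.succ = 0) ∧ (P₀ V V).trace = 0
    refine ⟨fun i j => ?_, ?_⟩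
    · rw [P₀_apply, if_neg (Fin.castSucc_lt_last i).ne, if_neg (Fin.succ_ne_zero j), sub_zero]
    · rw [P₀_eq, Matrix.trace_sub, Matrix.trace_mul_comm, sub_self]
  · rintro ⟨hY, ht⟩
    -- An interior diagonal position lies off the last row and the first column, so only the two end
    -- entries enter the trace.
    have hd : Y 0 0 + Y (Fin.last n) (Fin.last n) = 0 := by
      rw [← ht, Matrix.trace, Finset.sum_eq_add_of_mem 0 (Fin.last n) (Finset.mem_univ _)
        (Finset.mem_univ _) hl.symm]
      · rfl
      · rintro i - ⟨h0, h1⟩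
        obtain ⟨a, ha⟩ := exists_castSucc h1
        obtain ⟨b, hb⟩ := exists_succ h0
        rw [Matrix.diag_apply]
        nth_rewrite 1 [ha]
        rw [hb]
        exact hY a b
    -- The first row of `V` reproduces the last row of `[A, V]`, its last column minus the first
    -- column. The shared corner is `V 0 0 - V n n`; halving its value between the two entries keeps
    -- the trace zero.
    let V : Mat 𝕜 n := Matrix.of fun i j =>
      if i = 0 then (if j = 0 then (2⁻¹ : 𝕜) • Y (Fin.last n) 0 else Y (Fin.last n) j)
      else if j = Fin.last n then
        (if i = Fin.last n then -((2⁻¹ : 𝕜) • Y (Fin.last n) 0) else -Y i 0) else 0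
    have h2 : (2⁻¹ : 𝕜) • Y (Fin.last n) 0 + (2⁻¹ : 𝕜) • Y (Fin.last n) 0 = Y (Fin.last n) 0 := by
      rw [← add_smul, show (2⁻¹ + 2⁻¹ : 𝕜) = 1 by norm_num, one_smul]
    refine ⟨V, ?_, ?_⟩
    · rw [Matrix.trace, Finset.sum_eq_add_of_mem 0 (Fin.last n) (Finset.mem_univ _)
        (Finset.mem_univ _) hl.symm]
      · simp [V, hl]
      · rintro i - ⟨h0, h1⟩
        simp [V, h0, h1]
    · ext1 i j
      change P₀ V V i j = Y i j
      rw [P₀_apply]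
      by_cases hi : i = Fin.last n
      · subst hi
        by_cases hj : j = 0
        · subst hj
          simp [V, hl, h2]
        · simp [V, hj]
      · by_cases hj : j = 0
        · subst hj
          by_cases hi0 : i = 0
          · subst hi0
            simp [V, hl, hi, ← eq_neg_of_add_eq_zero_left hd]
          · simp [V, hi, hi0]
        · obtain ⟨a, rfl⟩ := exists_castSucc hi
          obtain ⟨b, rfl⟩ := exists_succ hj
          simp [hi, hj, hY]

theorem isHessenberg_matB : IsHessenberg (matB 𝕜 n) := fun i j => by
  simp [matB, Fin.ext_iff, eq_comm]

theorem trace_matB : (matB 𝕜 n).trace = 0 := by simp [Matrix.trace, matB]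

theorem mem_leafS (hn : 1 ≤ n) {S : Mat 𝕜 n} :
    S ∈ leafS 𝕜 n ↔ IsHessenberg S ∧ S.trace = 0 := by
  rw [leafS, Set.mem_ofPred_eq, mem_tangentS hn, Matrix.trace_sub, trace_matB, sub_zero]
  refine and_congr_left fun _ => forall₂_congr fun i j => ?_
  rw [Matrix.sub_apply, isHessenberg_matB i j, sub_eq_zero]

theorem pointQ_row (u : Fin n → Loop 𝕜) (i : Fin n) :
    pointQ u i.castSucc = Pi.single i.succ 1 := by
  funext j
  rw [pointQ, Matrix.add_apply, lastRow, Matrix.of_apply, if_neg (Fin.castSucc_lt_last i).ne]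
  simp [matB, Pi.single_apply, Fin.ext_iff]

theorem lastRow_apply_last (w : Fin n → Loop 𝕜) (j : Fin n) :
    lastRow w (Fin.last n) j.castSucc = w j := by
  simp [lastRow]

theorem lastRow_apply_last_last (w : Fin n → Loop 𝕜) : lastRow w (Fin.last n) (Fin.last n) = 0 := by
  simp [lastRow]

theorem lastRow_apply_castSucc (w : Fin n → Loop 𝕜) (i : Fin n) (j : Fin (n + 1)) :
    lastRow w i.castSucc j = 0 := by
  simp [lastRow, (Fin.castSucc_lt_last i).ne]

theorem matB_last (j : Fin (n + 1)) : matB 𝕜 n (Fin.last n) j = 0 := by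
  have := j.isLt
  simp [matB]
  omega

theorem pointQ_last (u : Fin n → Loop 𝕜) : pointQ u (Fin.last n) = lastRow u (Fin.last n) := by
  funext j
  simp [pointQ, matB_last]

theorem eq_lastRow {Y : Mat 𝕜 n} (h : ∀ (i : Fin n) j, Y i.castSucc j = 0) (ht : Y.trace = 0) :
    Y = lastRow fun j => Y (Fin.last n) j.castSucc := by
  ext1 i j
  refine Fin.lastCases ?_ (fun i => ?_) i
  · refine Fin.lastCases ?_ (fun j => ?_) j
    · rw [lastRow_apply_last_last, ← ht, Matrix.trace, Fin.sum_univ_castSucc]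
      simp [h]
    · rw [lastRow_apply_last]
  · rw [h, lastRow_apply_castSucc]

theorem lastRow_injective : Function.Injective (lastRow : (Fin n → Loop 𝕜) → Mat 𝕜 n) :=
  fun v w h => funext fun j => by
    rw [← lastRow_apply_last v, h, lastRow_apply_last]

theorem trace_lastRow (w : Fin n → Loop 𝕜) : (lastRow w).trace = 0 := by
  simp [Matrix.trace, Fin.sum_univ_castSucc, lastRow_apply_castSucc, lastRow_apply_last_last]

theorem isHessenberg_of_row {M : Mat 𝕜 n} (hM : ∀ i : Fin n, M i.castSucc = Pi.single i.succ 1) :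
    IsHessenberg M := fun i j => by simp [hM, Pi.single_apply, eq_comm]

theorem pointQ_mem_leafS (hn : 1 ≤ n) (u : Fin n → Loop 𝕜) : pointQ u ∈ leafS 𝕜 n :=
  (mem_leafS hn).2 ⟨isHessenberg_of_row (pointQ_row u), by
    rw [pointQ, Matrix.trace_add, trace_matB, trace_lastRow, add_zero]⟩

theorem lastRow_mem_tangentS (hn : 1 ≤ n) (w : Fin n → Loop 𝕜) : lastRow w ∈ tangentS 𝕜 n :=
  (mem_tangentS hn).2 ⟨fun i _ => lastRow_apply_castSucc w i _, trace_lastRow w⟩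

theorem frob_eq_pointQ (hn : 1 ≤ n) {S : Mat 𝕜 n} (hS : S ∈ leafS 𝕜 n) :
    frob S = pointQ (invariants S) := by
  obtain ⟨hH, ht⟩ := (mem_leafS hn).1 hS
  have h1 := eq_lastRow (Y := frob S - matB 𝕜 n) (fun i _ => by
      rw [Matrix.sub_apply, hH.frob_row]
      simp [matB, Pi.single_apply, Fin.ext_iff]) (by
      rw [Matrix.trace_sub, trace_matB, sub_zero, trace_gauge hH.uniLower_frame hH.frob_mul_frame,
        ht])
  rw [sub_eq_iff_eq_add'] at h1
  rw [h1, pointQ]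
  congr 2
  exact funext fun _ => by simp [invariants, matB_last]

theorem invariants_pointQ (u : Fin n → Loop 𝕜) : invariants (pointQ u) = u := by
  funext j
  rw [invariants, frob_of_row (pointQ_row u), pointQ_last, lastRow_apply_last]

/-! ### Gauge covariance -/

/-- `P₁` is the covariant derivative in the adjoint representation, hence gauge covariant. Both
hypotheses avoid inverses so that they can be substituted directly. -/
theorem P₁_gauge {S S₁ T V Z : Mat 𝕜 n} (hS : S₁ * T = mderiv T + T * S) (hZ : Z * T = T * V) :
    P₁ S₁ Z * T = T * P₁ S V := by
  have h1 : mderiv Z * T + Z * mderiv T = mderiv T * V + T * mderiv V := by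
    rw [← mderiv_mul, hZ, mderiv_mul]
  have h2 : Z * S₁ * T = Z * mderiv T + T * V * S := by
    rw [mul_assoc, hS, mul_add, ← mul_assoc, hZ]
  have h3 : S₁ * Z * T = mderiv T * V + T * S * V := by
    rw [mul_assoc, hZ, ← mul_assoc, hS, add_mul]
  rw [P₁_eq, P₁_eq, add_mul, sub_mul, h2, h3, eq_sub_of_add_eq h1, mul_add, mul_sub, mul_assoc,
    mul_assoc]
  abel

/-- The velocity of a curve of matrices. -/
def matVelocity (t : ℝ) (F : Matrix (Fin (n + 1)) (Fin (n + 1)) (LoopCurve 𝕜)) : Mat 𝕜 n :=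
  F.map (velocity t)

variable {F G : Matrix (Fin (n + 1)) (Fin (n + 1)) (LoopCurve 𝕜)}

theorem matVelocity_add (t : ℝ) : matVelocity t (F + G) = matVelocity t F + matVelocity t G := by
  ext1 i j
  exact velocity_add t _ _

/-- `velocity t` as an additive map. -/
def velocityHom (t : ℝ) : LoopCurve 𝕜 →+ Loop 𝕜 := AddMonoidHom.mk' (velocity t) (velocity_add t)

theorem matVelocity_mul (t : ℝ) : matVelocity t (F * G) =
    matVelocity t F * G.map (evalAt 𝕜 t) + F.map (evalAt 𝕜 t) * matVelocity t G := by
  ext1 i j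
  change velocityHom t ((F * G) i j) = _
  rw [Matrix.mul_apply, map_sum, Matrix.add_apply, Matrix.mul_apply, Matrix.mul_apply,
    ← Finset.sum_add_distrib]
  exact Finset.sum_congr rfl fun k _ => velocity_mul t _ _

theorem matVelocity_mderiv (t : ℝ) : matVelocity t (mderiv F) = mderiv (matVelocity t F) := by
  ext1 i j
  exact velocity_deriv t _

theorem mderiv_map_evalAt (t : ℝ) : (mderiv F).map (evalAt 𝕜 t) = mderiv (F.map (evalAt 𝕜 t)) := rfl

theorem matCurve_ext (h : ∀ t, F.map (evalAt 𝕜 t) = G.map (evalAt 𝕜 t)) : F = G := by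
  ext1 i j
  exact loopCurve_ext fun t => congrFun (congrFun (h t) i) j

theorem trace_matVelocity (t : ℝ) : (matVelocity t F).trace = velocity t F.trace :=
  (map_sum (velocityHom t) (fun i => F i i) Finset.univ).symm

/-- Differentiating a gauge transformation. -/
theorem velocity_gauge {S S₁ T : Matrix (Fin (n + 1)) (Fin (n + 1)) (LoopCurve 𝕜)}
    (hS : S₁ * T = mderiv T + T * S) (t : ℝ) {W : Mat 𝕜 n}
    (hW : W * T.map (evalAt 𝕜 t) = matVelocity t T) :
    matVelocity t S₁ * T.map (evalAt 𝕜 t) =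
      P₁ (S₁.map (evalAt 𝕜 t)) W * T.map (evalAt 𝕜 t) + T.map (evalAt 𝕜 t) * matVelocity t S := by
  have h1 := congrArg (matVelocity t) hS
  rw [matVelocity_mul, matVelocity_add, matVelocity_mul, matVelocity_mderiv, ← hW, mderiv_mul] at h1
  have h2 := congrArg (fun F => F.map (evalAt 𝕜 t)) hS
  rw [Matrix.map_mul, Matrix.map_add _ (map_add _), Matrix.map_mul, mderiv_map_evalAt] at h2
  rw [eq_sub_of_add_eq h1, P₁_eq, add_mul, sub_mul, mul_assoc W (S₁.map _), h2, mul_add]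
  simp only [mul_assoc]
  abel

/-! ### The kernel of `P₀` -/

theorem StrictLower.apply_last {V : Mat 𝕜 n} (hV : StrictLower V) (i : Fin (n + 1)) :
    V i (Fin.last n) = 0 := hV i _ (Fin.le_last i)

theorem StrictLower.apply_zero {V : Mat 𝕜 n} (hV : StrictLower V) (j : Fin (n + 1)) : V 0 j = 0 :=
  hV 0 j (Fin.zero_le j)

theorem StrictLower.P₀_eq_zero {V : Mat 𝕜 n} (hV : StrictLower V) (S : Mat 𝕜 n) : P₀ S V = 0 := by
  ext1 i j
  rw [P₀_apply, hV.apply_last, hV.apply_zero, ite_self, ite_self, sub_zero]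
  rfl

theorem StrictLower.P₁_mem_distD {V : Mat 𝕜 n} (hV : StrictLower V) (S : Mat 𝕜 n) :
    P₁ S V ∈ distD S := ⟨V, hV.trace, hV.P₀_eq_zero S, rfl⟩

theorem loop_eq_zero_of_nsmul {m : ℕ} {c : Loop 𝕜} (h : (m + 1) • c = 0) : c = 0 := by
  refine Subtype.ext (funext fun x => ?_)
  have := congrArg (fun f : Loop 𝕜 => f.1 x) h
  have h2 : (m + 1) • c.1 x = 0 := this
  rw [nsmul_eq_mul] at h2
  exact (mul_eq_zero.1 h2).resolve_left (by exact_mod_cast Nat.succ_ne_zero m)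

/-- A traceless matrix whose last column vanishes above the diagonal and whose image under `P₁`
is supported on the last row and the first column is strictly lower triangular. -/
theorem strictLower_of_P₁ {S V : Mat 𝕜 n} (hS : IsHessenberg S) (ht : V.trace = 0)
    (hl : ∀ i : Fin n, V i.castSucc (Fin.last n) = 0)
    (hP : ∀ i j : Fin n, P₁ S V i.castSucc j.succ = 0) : StrictLower V := by
  set c := V (Fin.last n) (Fin.last n) with hc
  -- The vanishing of the entry `(i, j + 1)` reduces to `V i j = V (i+1) (j+1)` once column `j + 1`
  -- is known. Working from the last column leftwards gives `c` times the identity on and above the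
  -- diagonal, and the trace then forces `(n + 1) c = 0`.
  have key : ∀ j i, i ≤ j → V i j = if i = j then c else 0 := by
    intro j
    induction j using Fin.reverseInduction with
    | last =>
      intro i _
      refine Fin.lastCases ?_ (fun i => ?_) i
      · simp [hc]
      · rw [hl, if_neg (Fin.castSucc_lt_last i).ne]
    | cast j ih =>
      intro i hij
      obtain ⟨i, rfl⟩ := exists_castSucc (i := i)
        (hij.trans_lt (Fin.castSucc_lt_last j)).ne
      have hij' : i ≤ j := by simpa using hij
      have h := hP i j
      have h1 : i.castSucc < j.succ := Fin.lt_def.2 (by simp; omega)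
      rw [P₁_apply, cov, hS.vecMul, hS.mul_apply, hl, ih i.succ (Fin.succ_le_succ_iff.2 hij'),
        ih 0 (Fin.zero_le _), ih i.castSucc h1.le, if_neg h1.ne,
        if_neg (Fin.succ_ne_zero j).symm] at h
      simp only [map_zero, zero_mul, add_zero, zero_add, mul_zero, Fin.succ_inj] at h
      rw [sub_eq_zero.1 h]
      simp
  have hc0 : c = 0 := by
    refine loop_eq_zero_of_nsmul (m := n) ?_
    rw [← ht, Matrix.trace, Finset.sum_congr rfl (g := fun _ => c) fun i _ => ?_]
    · simp
    · rw [Matrix.diag_apply, key i i le_rfl, if_pos rfl]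
  intro i j hij
  rw [key j i hij, hc0, ite_self]

/-- A strictly lower triangular matrix is determined by the rows of its image under `P₁`. -/
theorem eq_zero_of_P₁_eq_lastRow {Q W : Mat 𝕜 n}
    (hQ : ∀ i : Fin n, Q i.castSucc = Pi.single i.succ 1) {w : Fin n → Loop 𝕜}
    (hW : ∀ j, W 0 j = 0) (h : P₁ Q W = lastRow w) : W = 0 ∧ w = 0 := by
  -- Row `i` of the equation says that row `i + 1` of `W` is the covariant derivative of row `i`, so
  -- the zero first row propagates.
  have hrow : ∀ i : Fin (n + 1), W i = 0 := by
    intro i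
    induction i using Fin.induction with
    | zero => exact funext hW
    | succ i ih =>
      funext j
      have h1 := congrFun (congrFun h i.castSucc) j
      rw [P₁_apply, lastRow_apply_castSucc, (isHessenberg_of_row hQ).mul_apply, hW, mul_zero,
        add_zero, ih, sub_eq_zero] at h1
      rw [← h1]
      simp [cov]
  have hW0 : W = 0 := by
    ext1 i j
    rw [hrow]
    rfl
  refine ⟨hW0, lastRow_injective (𝕜 := 𝕜) ?_⟩
  rw [← h, hW0, P₁_zero]
  ext1 i j
  refine Fin.lastCases ?_ (fun i => ?_) i
  · refine Fin.lastCases ?_ (fun j => ?_) j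
    · rw [lastRow_apply_last_last]; rfl
    · rw [lastRow_apply_last]; rfl
  · rw [lastRow_apply_castSucc]; rfl

/-- The kernel of `P₀` forces the last column to vanish above the diagonal, which starts the
induction of `strictLower_of_P₁`. -/
theorem exists_strictLower_of_mem_distE (hn : 1 ≤ n) {S Y : Mat 𝕜 n} (hS : S ∈ leafS 𝕜 n)
    (hY : Y ∈ distE S) : ∃ V, StrictLower V ∧ P₁ S V = Y := by
  obtain ⟨⟨V, ht, hV, rfl⟩, hT⟩ := hY
  refine ⟨V, strictLower_of_P₁ ((mem_leafS hn).1 hS).1 ht (fun i => ?_) ((mem_tangentS hn).1 hT).1,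
    rfl⟩
  have := congrFun (congrFun hV i.castSucc) 0
  rw [P₀_apply, if_neg (Fin.castSucc_lt_last i).ne, if_pos rfl, zero_sub] at this
  exact neg_eq_zero.1 this

end Reduction

/-! ## The projection onto the quotient -/

section Projection

variable {𝕜 : Type*} [RCLike 𝕜] {n : ℕ}

theorem frob_map_evalAt (F : Matrix (Fin (n + 1)) (Fin (n + 1)) (LoopCurve 𝕜)) (t : ℝ) :
    frob (F.map (evalAt 𝕜 t)) = (frob F).map (evalAt 𝕜 t) := frob_map F (evalAt_deriv t)

theorem frame_map_evalAt (F : Matrix (Fin (n + 1)) (Fin (n + 1)) (LoopCurve 𝕜)) (t : ℝ) :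
    frame (F.map (evalAt 𝕜 t)) = (frame F).map (evalAt 𝕜 t) := frame_map F (evalAt_deriv t)

theorem strictLower_matVelocity {T : Matrix (Fin (n + 1)) (Fin (n + 1)) (LoopCurve 𝕜)}
    (hT : ∀ t, UniLower (T.map (evalAt 𝕜 t))) (t : ℝ) : StrictLower (matVelocity t T) :=
  fun i j hij => velocity_eq_zero_of_const t fun s => uniLower_iff.1 (hT s) i j hij

theorem matVelocity_mem_tangentS (hn : 1 ≤ n)
    {F : Matrix (Fin (n + 1)) (Fin (n + 1)) (LoopCurve 𝕜)}
    (hF : ∀ t, F.map (evalAt 𝕜 t) ∈ leafS 𝕜 n) (t : ℝ) : matVelocity t F ∈ tangentS 𝕜 n := by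
  refine (mem_tangentS hn).2 ⟨fun i j => ?_, ?_⟩
  · exact velocity_eq_zero_of_const t fun s => ((mem_leafS hn).1 (hF s)).1 i j
  · rw [trace_matVelocity]
    refine velocity_eq_zero_of_const t (g := 0) fun s => ?_
    rw [← ((mem_leafS hn).1 (hF s)).2]
    exact map_sum (evalAt 𝕜 s) (fun i => F i i) Finset.univ

theorem frob_mul_frame_curve (hn : 1 ≤ n) {F : Matrix (Fin (n + 1)) (Fin (n + 1)) (LoopCurve 𝕜)}
    (hF : ∀ t, F.map (evalAt 𝕜 t) ∈ leafS 𝕜 n) :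
    frob F * frame F = mderiv (frame F) + frame F * F := by
  refine matCurve_ext fun t => ?_
  rw [Matrix.map_mul, Matrix.map_add _ (map_add _), Matrix.map_mul, mderiv_map_evalAt,
    ← frob_map_evalAt, ← frame_map_evalAt]
  exact ((mem_leafS hn).1 (hF t)).1.frob_mul_frame

/-- The velocity of the invariants of a curve in the leaf. -/
theorem exists_lastRow_velocity_invariants (hn : 1 ≤ n)
    {F : Matrix (Fin (n + 1)) (Fin (n + 1)) (LoopCurve 𝕜)}
    (hF : ∀ t, F.map (evalAt 𝕜 t) ∈ leafS 𝕜 n) (t : ℝ) :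
    matVelocity t (frob F) = lastRow (fun j => velocity t (invariants F j)) ∧
    ∃ W : Mat 𝕜 n, StrictLower W ∧ lastRow (fun j => velocity t (invariants F j)) =
      P₁ (frob (F.map (evalAt 𝕜 t))) W +
        frame (F.map (evalAt 𝕜 t)) * matVelocity t F * (frame (F.map (evalAt 𝕜 t)))⁻¹ := by
  have hU : ∀ s, UniLower ((frame F).map (evalAt 𝕜 s)) := fun s => by
    rw [← frame_map_evalAt]
    exact ((mem_leafS hn).1 (hF s)).1.uniLower_frame
  have hlast : matVelocity t (frob F) = lastRow (fun j => velocity t (invariants F j)) := by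
    have hQ : ∀ s, (frob F).map (evalAt 𝕜 s) = pointQ (invariants (F.map (evalAt 𝕜 s))) :=
      fun s => by rw [← frob_map_evalAt, frob_eq_pointQ hn (hF s)]
    refine eq_lastRow (fun i j => velocity_eq_zero_of_const t (g := matB 𝕜 n i.castSucc j)
      fun s => ?_) ?_
    · have := congrFun (congrFun (hQ s) i.castSucc) j
      rw [pointQ, Matrix.add_apply, lastRow_apply_castSucc, add_zero] at this
      exact this
    · rw [trace_matVelocity]
      refine velocity_eq_zero_of_const t (g := 0) fun s => ?_
      have h0 := ((mem_leafS hn).1 (pointQ_mem_leafS hn (invariants (F.map (evalAt 𝕜 s))))).2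
      rw [← hQ] at h0
      rw [← h0]
      exact map_sum (evalAt 𝕜 s) (fun i => frob F i i) Finset.univ
  refine ⟨hlast, matVelocity t (frame F) * ((frame F).map (evalAt 𝕜 t))⁻¹, ?_, ?_⟩
  · exact StrictLower.of_mul (strictLower_matVelocity hU t) (hU t)
      ((hU t).inv_mul_cancel_right _)
  · have h := velocity_gauge (frob_mul_frame_curve hn hF) t ((hU t).inv_mul_cancel_right _)
    refine (hU t).mul_right_cancel ?_
    rw [← hlast, h, add_mul, frob_map_evalAt, frame_map_evalAt, (hU t).inv_mul_cancel_right]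

theorem UniLower.conj_strictLower {T V : Mat 𝕜 n} (hT : UniLower T) (hV : StrictLower V) :
    StrictLower (T * V * T⁻¹) :=
  StrictLower.of_mul (hT.mul_strictLower hV) hT (hT.inv_mul_cancel_right _)

theorem P₁_conj {S T V Q : Mat 𝕜 n} (hT : UniLower T) (hS : Q * T = mderiv T + T * S) :
    P₁ Q (T * V * T⁻¹) = T * P₁ S V * T⁻¹ := by
  refine hT.mul_right_cancel ?_
  rw [P₁_gauge hS (hT.inv_mul_cancel_right _), hT.inv_mul_cancel_right]

theorem frob_row (hn : 1 ≤ n) {S : Mat 𝕜 n} (hS : S ∈ leafS 𝕜 n) (i : Fin n) :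
    frob S i.castSucc = Pi.single i.succ 1 := ((mem_leafS hn).1 hS).1.frob_row i

/-- The invariants are constant on the leaves of `E`. -/
theorem SameLeaf.frob_eq (hn : 1 ≤ n) {S S' : Mat 𝕜 n} (h : SameLeaf S S') : frob S = frob S' := by
  obtain ⟨γ, hγ, h0, h1, hE⟩ := h
  let F : Matrix (Fin (n + 1)) (Fin (n + 1)) (LoopCurve 𝕜) :=
    Matrix.of fun i j => ⟨fun t => γ t i j, hγ i j⟩
  have hF : ∀ t, F.map (evalAt 𝕜 t) = γ t := fun t => rfl
  have hleaf : ∀ t, F.map (evalAt 𝕜 t) ∈ leafS 𝕜 n := fun t => (hE t).1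
  have hv : ∀ t, matVelocity t (frob F) = 0 := by
    intro t
    obtain ⟨hlast, W, hW, hWeq⟩ := exists_lastRow_velocity_invariants hn hleaf t
    obtain ⟨-, Y, hY, hder⟩ := hE t
    have hvY : matVelocity t F = Y := by
      ext1 i j
      exact velocity_eq fun x => hder i j x
    obtain ⟨V, hV, rfl⟩ := exists_strictLower_of_mem_distE hn (hE t).1 hY
    obtain ⟨hH, -⟩ := (mem_leafS hn).1 (hleaf t)
    -- Moved to the normal form, the velocity along `E` becomes `P₁` of a strictly lower triangular
    -- matrix, as is the motion of the frame. Their sum is tangent to the transversal, hence zero.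
    have hZ := P₁_conj (V := V) hH.uniLower_frame hH.frob_mul_frame
    rw [hvY, ← hF t, ← hZ, ← P₁_add] at hWeq
    have hs := hW.add (hH.uniLower_frame.conj_strictLower hV)
    have := eq_zero_of_P₁_eq_lastRow (frob_row hn (hleaf t)) hs.apply_zero hWeq.symm
    rw [hlast, hWeq, this.1, P₁_zero]
  have h2 : (frob F).map (evalAt 𝕜 0) = (frob F).map (evalAt 𝕜 1) := by
    ext1 i j
    exact eq_of_velocity_eq_zero (fun t => congrFun (congrFun (hv t) i) j) 0 1
  rw [← frob_map_evalAt, ← frob_map_evalAt, hF, hF, h0, h1] at h2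
  exact h2

theorem smul_algebraMap_mul (c : 𝕜) (f : Loop 𝕜) : algebraMap 𝕜 (Loop 𝕜) c * f = c • f :=
  (Algebra.smul_def c f).symm

/-- The straight line through `S` with velocity `Y`. -/
def lineCurve (S Y : Mat 𝕜 n) : Matrix (Fin (n + 1)) (Fin (n + 1)) (LoopCurve 𝕜) :=
  S.map constCurve + (timeCurve : LoopCurve 𝕜) • Y.map constCurve

theorem lineCurve_evalAt (S Y : Mat 𝕜 n) (t : ℝ) :
    (lineCurve S Y).map (evalAt 𝕜 t) = S + (t : 𝕜) • Y := by
  ext1 i j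
  change S i j + algebraMap 𝕜 (Loop 𝕜) (t : 𝕜) * Y i j = S i j + (t : 𝕜) • Y i j
  rw [smul_algebraMap_mul]

theorem velocity_lineCurve (S Y : Mat 𝕜 n) (t : ℝ) : matVelocity t (lineCurve S Y) = Y := by
  ext1 i j
  change velocity t (constCurve (S i j) + timeCurve * constCurve (Y i j)) = Y i j
  rw [velocity_add, velocity_mul, velocity_constCurve, velocity_constCurve, velocity_timeCurve,
    evalAt_constCurve, zero_add, mul_zero, add_zero, one_mul]

/-- Every point of the leaf is joined to its normal form. -/
theorem sameLeaf_frob (hn : 1 ≤ n) {S : Mat 𝕜 n} (hS : S ∈ leafS 𝕜 n) : SameLeaf S (frob S) := by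
  obtain ⟨hH, htr⟩ := (mem_leafS hn).1 hS
  -- The gauge matrix is interpolated affinely from the identity to the frame; unitriangularity
  -- persists.
  obtain ⟨T, hTt⟩ : ∃ T : Matrix (Fin (n + 1)) (Fin (n + 1)) (LoopCurve 𝕜),
      ∀ t, T.map (evalAt 𝕜 t) = 1 + (t : 𝕜) • (frame S - 1) :=
    ⟨_, lineCurve_evalAt 1 (frame S - 1)⟩
  obtain ⟨F, hF⟩ : ∃ F : Matrix (Fin (n + 1)) (Fin (n + 1)) (LoopCurve 𝕜),
      F = (mderiv T + T * S.map constCurve) * T.adjugate := ⟨_, rfl⟩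
  have hU : ∀ t, UniLower (T.map (evalAt 𝕜 t)) := by
    intro t i j hij
    rw [hTt, add_sub_cancel_left, Matrix.smul_apply, hH.uniLower_frame i j hij, smul_zero]
  have hSt : ∀ t, (S.map constCurve).map (evalAt 𝕜 t) = S := fun t => rfl
  have hFt : ∀ t, F.map (evalAt 𝕜 t) = (mderiv (T.map (evalAt 𝕜 t)) + T.map (evalAt 𝕜 t) * S) *
      (T.map (evalAt 𝕜 t)).adjugate := by
    intro t
    have h : T.adjugate.map (evalAt 𝕜 t) = (T.map (evalAt 𝕜 t)).adjugate :=
      (evalAt 𝕜 t).map_adjugate T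
    rw [hF, Matrix.map_mul, Matrix.map_add _ (map_add _), Matrix.map_mul, mderiv_map_evalAt, h, hSt]
  have hFT : F * T = mderiv T + T * S.map constCurve := by
    refine matCurve_ext fun t => ?_
    rw [Matrix.map_mul, Matrix.map_add _ (map_add _), Matrix.map_mul, mderiv_map_evalAt, hFt, hSt,
      mul_assoc, (hU t).adjugate_mul, mul_one]
  have hFTt : ∀ t, F.map (evalAt 𝕜 t) * T.map (evalAt 𝕜 t) =
      mderiv (T.map (evalAt 𝕜 t)) + T.map (evalAt 𝕜 t) * S := by
    intro t
    rw [hFt, mul_assoc, (hU t).adjugate_mul, mul_one]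
  have hleaf : ∀ t, F.map (evalAt 𝕜 t) ∈ leafS 𝕜 n := by
    intro t
    refine (mem_leafS hn).2 ⟨isHessenberg_gauge (hU t) (hFTt t) fun i j => ?_, ?_⟩
    · have e : mderiv (T.map (evalAt 𝕜 t)) = (t : 𝕜) • mderiv (frame S) := by
        rw [hTt]
        ext1 i j
        have h1 : ((1 : Mat 𝕜 n) i j)′ = 0 :=
          congrFun (congrFun (mderiv_one (R := Loop 𝕜) (n := n)) i) j
        change ((1 : Mat 𝕜 n) i j + (t : 𝕜) • (frame S i j - (1 : Mat 𝕜 n) i j))′ =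
          (t : 𝕜) • ((frame S i j)′)
        rw [map_add, loop_deriv_smul, map_sub, h1, zero_add, sub_zero]
      -- `T' + T S` is affine in `t`, so the Hessenberg condition on rows follows from its validity
      -- at the two endpoints.
      have h1 : (mderiv (T.map (evalAt 𝕜 t)) + T.map (evalAt 𝕜 t) * S) =
          S + (t : 𝕜) • (mderiv (frame S) + frame S * S - S) := by
        rw [e, hTt, add_mul, one_mul, Matrix.smul_mul, sub_mul, one_mul]
        module
      rw [← row_mderiv_add_mul, h1, hTt]
      simp only [Matrix.add_apply, Matrix.smul_apply, Matrix.sub_apply]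
      rw [← Matrix.add_apply, row_mderiv_add_mul, frame_row_succ, hH i j, Matrix.one_apply]
      simp only [Fin.succ_inj]
    · rw [trace_gauge (hU t) (hFTt t), htr]
  refine ⟨fun t => F.map (evalAt 𝕜 t), fun i j => (F i j).2, ?_, ?_, fun t => ⟨hleaf t,
    matVelocity t F, ⟨?_, matVelocity_mem_tangentS hn hleaf t⟩, fun i j x =>
      hasDerivAt_velocity (F i j) t x⟩⟩
  · have h0 : T.map (evalAt 𝕜 0) = 1 := by rw [hTt]; simp
    simp only [hFt, h0, mderiv_one, zero_add, one_mul, Matrix.adjugate_one, mul_one]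
  · have h1 : T.map (evalAt 𝕜 1) = frame S := by rw [hTt]; simp
    simp only [hFt, h1]
    rfl
  · have hW := (hU t).inv_mul_cancel_right (matVelocity t T)
    have h := velocity_gauge hFT t hW
    have hs := StrictLower.of_mul (strictLower_matVelocity hU t) (hU t) hW
    have hc : matVelocity t (S.map constCurve) = 0 := by
      ext1 i j
      exact velocity_constCurve t _
    rw [hc, mul_zero, add_zero] at h
    rw [(hU t).mul_right_cancel h]
    exact hs.P₁_mem_distD _

theorem proj_iff (hn : 1 ≤ n) {S : Mat 𝕜 n} (hS : S ∈ leafS 𝕜 n) {u : Fin n → Loop 𝕜} :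
    Proj S u ↔ u = invariants S := by
  constructor
  · intro h
    have := SameLeaf.frob_eq hn h
    rw [← invariants_pointQ u]
    funext j
    rw [invariants, invariants, this]
  · rintro rfl
    rw [Proj, ← frob_eq_pointQ hn hS]
    exact sameLeaf_frob hn hS

/-! ### The tangent map of the projection -/

theorem line_mem_leafS (hn : 1 ≤ n) {S Y : Mat 𝕜 n} (hS : S ∈ leafS 𝕜 n) (hY : Y ∈ tangentS 𝕜 n)
    (c : 𝕜) : S + c • Y ∈ leafS 𝕜 n := by
  rw [mem_leafS hn] at hS ⊢
  rw [mem_tangentS hn] at hY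
  refine ⟨fun i j => ?_, ?_⟩
  · rw [Matrix.add_apply, Matrix.smul_apply, hY.1, smul_zero, add_zero, hS.1]
  · rw [Matrix.trace_add, Matrix.trace_smul, hS.2, hY.2, smul_zero, add_zero]

/-- The differential of the invariants. -/
def dInvariants (S Y : Mat 𝕜 n) (j : Fin n) : Loop 𝕜 := velocity 0 (invariants (lineCurve S Y) j)

theorem exists_lastRow_dInvariants (hn : 1 ≤ n) {S Y : Mat 𝕜 n} (hS : S ∈ leafS 𝕜 n)
    (hY : Y ∈ tangentS 𝕜 n) : ∃ W : Mat 𝕜 n, StrictLower W ∧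
      lastRow (dInvariants S Y) = P₁ (frob S) W + frame S * Y * (frame S)⁻¹ := by
  have h := (exists_lastRow_velocity_invariants hn (F := lineCurve S Y) (fun t => by
    rw [lineCurve_evalAt]
    exact line_mem_leafS hn hS hY _) 0).2
  rw [lineCurve_evalAt, velocity_lineCurve, RCLike.ofReal_zero, zero_smul, add_zero] at h
  exact h

/-- Two such representations differ by `P₁` of a strictly lower triangular matrix lying along the
transversal, which must vanish. -/
theorem dInvariants_eq (hn : 1 ≤ n) {S Y W : Mat 𝕜 n} (hS : S ∈ leafS 𝕜 n)
    (hY : Y ∈ tangentS 𝕜 n) (hW : StrictLower W) {w : Fin n → Loop 𝕜}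
    (h : lastRow w = P₁ (frob S) W + frame S * Y * (frame S)⁻¹) : dInvariants S Y = w := by
  obtain ⟨W', hW', h'⟩ := exists_lastRow_dInvariants hn hS hY
  have h2 : P₁ (frob S) (W' - W) = lastRow (dInvariants S Y - w) := by
    have e : lastRow (dInvariants S Y - w) = lastRow (dInvariants S Y) - lastRow w := by
      ext1 i j
      refine Fin.lastCases ?_ (fun i => ?_) i
      · refine Fin.lastCases ?_ (fun j => ?_) j
        · simp [lastRow_apply_last_last]
        · simp [lastRow_apply_last]
      · simp [lastRow_apply_castSucc]
    rw [e, h, h', P₁_sub]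
    abel
  exact sub_eq_zero.1
    (eq_zero_of_P₁_eq_lastRow (frob_row hn hS) (hW'.sub hW).apply_zero h2).2

theorem tangentProj_iff (hn : 1 ≤ n) {S Y : Mat 𝕜 n} (hS : S ∈ leafS 𝕜 n)
    (hY : Y ∈ tangentS 𝕜 n) {w : Fin n → Loop 𝕜} : TangentProj S Y w ↔ w = dInvariants S Y := by
  have hinv : ∀ (ε : ℝ) j, invariants (S + (ε : 𝕜) • Y) j =
      evalAt 𝕜 ε (invariants (lineCurve S Y) j) := by
    intro ε j
    rw [← lineCurve_evalAt, invariants, frob_map_evalAt]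
    rfl
  have hder : ∀ j x, HasDerivAt (fun ε : ℝ => (invariants (S + (ε : 𝕜) • Y) j).1 x)
      ((dInvariants S Y j).1 x) 0 := by
    intro j x
    simp only [hinv]
    exact hasDerivAt_velocity _ 0 x
  constructor
  · rintro ⟨c, hc, hd⟩
    funext j
    refine Subtype.ext (funext fun x => ?_)
    refine (hd j x).unique ?_
    have : c = fun ε : ℝ => invariants (S + (ε : 𝕜) • Y) :=
      funext fun ε => (proj_iff hn (line_mem_leafS hn hS hY _)).1 (hc ε)
    rw [this]
    exact hder j x
  · rintro rfl
    exact ⟨fun ε => invariants (S + (ε : 𝕜) • Y),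
      fun ε => (proj_iff hn (line_mem_leafS hn hS hY _)).2 rfl, hder⟩

end Projection

/-! ## Lifts of covectors -/

section Lifts

variable {𝕜 : Type*} [RCLike 𝕜] {n : ℕ}

theorem matPairing_add_right (V X Y : Mat 𝕜 n) :
    matPairing V (X + Y) = matPairing V X + matPairing V Y := by
  rw [matPairing, mul_add, Matrix.trace_add, loopIntegral_add]; rfl

theorem matPairing_sub_right (V X Y : Mat 𝕜 n) :
    matPairing V (X - Y) = matPairing V X - matPairing V Y := by
  rw [matPairing, mul_sub, Matrix.trace_sub, loopIntegral_sub]; rfl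

/-- The tensor `P₁` is skew-symmetric. -/
theorem matPairing_P₁ (S V W : Mat 𝕜 n) : matPairing V (P₁ S W) = -matPairing (P₁ S V) W := by
  refine eq_neg_of_add_eq_zero_left ?_
  have h : (V * P₁ S W).trace + (P₁ S V * W).trace = (V * W).trace′ := by
    rw [← trace_mderiv, mderiv_mul, P₁_eq, P₁_eq]
    simp only [mul_add, mul_sub, add_mul, sub_mul, Matrix.trace_add, Matrix.trace_sub]
    rw [← mul_assoc V W S, Matrix.trace_mul_comm (V * W) S, ← mul_assoc S V W, ← mul_assoc V S W]
    ring
  rw [matPairing, matPairing, ← loopIntegral_add, h, loopIntegral_deriv]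

/-- The image of the skew tensor `P₀` is orthogonal to its kernel. -/
theorem matPairing_of_mem_tangentS {Y W S : Mat 𝕜 n} (hY : Y ∈ tangentS 𝕜 n) (hW : P₀ S W = 0) :
    matPairing Y W = 0 := by
  obtain ⟨U, -, rfl⟩ := hY
  have h : ((matA 𝕜 n * U - U * matA 𝕜 n) * W).trace = -(U * P₀ S W).trace := by
    rw [P₀_eq, sub_mul, mul_sub, Matrix.trace_sub, Matrix.trace_sub, mul_assoc (matA 𝕜 n),
      Matrix.trace_mul_comm (matA 𝕜 n), mul_assoc, mul_assoc]
    ring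
  change loopIntegral ((matA 𝕜 n * U - U * matA 𝕜 n) * W).trace = 0
  rw [h, hW, mul_zero, Matrix.trace_zero, neg_zero, loopIntegral_zero]

theorem matPairing_single (Y : Mat 𝕜 n) (i j : Fin (n + 1)) (f : Loop 𝕜) :
    matPairing Y (Matrix.single j i f) = loopIntegral (f * Y i j) := by
  rw [matPairing, Matrix.trace_mul_comm, Matrix.trace_single_mul]
  rfl

theorem matPairing_smul_one {Y : Mat 𝕜 n} (hY : Y.trace = 0) (f : Loop 𝕜) :
    matPairing Y (f • (1 : Mat 𝕜 n)) = 0 := by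
  rw [matPairing, Matrix.mul_smul, mul_one, Matrix.trace_smul, hY, smul_zero, loopIntegral_zero]

theorem matPairing_lastRow (V : Mat 𝕜 n) (w : Fin n → Loop 𝕜) :
    matPairing V (lastRow w) = redPairing (fun j => V j.castSucc (Fin.last n)) w := by
  have h : (V * lastRow w).trace = ∑ j : Fin n, V j.castSucc (Fin.last n) * w j := by
    rw [Matrix.trace, Fin.sum_univ_castSucc]
    simp [Matrix.mul_apply, Fin.sum_univ_castSucc, lastRow_apply_castSucc, lastRow_apply_last,
      lastRow_apply_last_last]
  rw [matPairing, h, loopIntegral_sum]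
  rfl

theorem eq_of_redPairing {v v' : Fin n → Loop 𝕜} (h : ∀ w, redPairing v w = redPairing v' w) :
    v = v' := by
  funext j
  refine sub_eq_zero.1 (eq_zero_of_forall_loopIntegral fun g => ?_)
  have h1 : ∀ v : Fin n → Loop 𝕜, redPairing v (Pi.single j g) = loopIntegral (v j * g) := by
    intro v
    rw [redPairing, Finset.sum_eq_single j]
    · simp
    · intro k _ hk
      simp [hk, loopIntegral_zero]
    · simp
  have := h (Pi.single j g)
  rw [h1, h1] at this
  rw [mul_sub, loopIntegral_sub, mul_comm g, mul_comm g, this, sub_self]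

/-- A covector that annihilates `D` is mapped by `P₁` to the tangent space of the leaf. -/
theorem P₁_mem_tangentS (hn : 1 ≤ n) {S β : Mat 𝕜 n} (ht : β.trace = 0)
    (h : ∀ Y ∈ distD S, matPairing β Y = 0) : P₁ S β ∈ tangentS 𝕜 n := by
  have htr := trace_P₁ S ht
  refine (mem_tangentS hn).2 ⟨fun i j => eq_zero_of_forall_loopIntegral fun f => ?_, htr⟩
  let c : Loop 𝕜 := ((n + 1 : 𝕜)⁻¹) • (Matrix.single j.succ i.castSucc f : Mat 𝕜 n).trace
  -- An elementary matrix with no entry in the first row or last column commutes with `A`.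
  -- Subtracting a multiple of the identity restores trace zero and changes neither the commutator
  -- nor the pairing with a traceless matrix.
  let V : Mat 𝕜 n := Matrix.single j.succ i.castSucc f - c • (1 : Mat 𝕜 n)
  have hn1 : (n + 1 : 𝕜) ≠ 0 := by exact_mod_cast Nat.succ_ne_zero n
  have hVt : V.trace = 0 := by
    rw [Matrix.trace_sub, Matrix.trace_smul, Matrix.trace_one, Fintype.card_fin, smul_eq_mul,
      sub_eq_zero]
    have : ((n + 1 : ℕ) : Loop 𝕜) = algebraMap 𝕜 (Loop 𝕜) (n + 1 : 𝕜) := by simp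
    rw [this, mul_comm, smul_algebraMap_mul, smul_smul, mul_inv_cancel₀ hn1, one_smul]
  have hV0 : P₀ S V = 0 := by
    rw [P₀_eq, mul_sub, sub_mul, Matrix.mul_smul, Matrix.smul_mul, mul_one, one_mul,
      sub_sub_sub_cancel_right, ← P₀_eq S]
    ext1 a b
    rw [P₀_apply]
    simp [Fin.succ_ne_zero, (Fin.castSucc_lt_last i).ne]
  have h1 := h _ ⟨V, hVt, hV0, rfl⟩
  rw [matPairing_P₁, neg_eq_zero, matPairing_sub_right, matPairing_smul_one htr, sub_zero,
    matPairing_single] at h1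
  exact h1

theorem IsLift.P₁_mem (hn : 1 ≤ n) {v : Fin n → Loop 𝕜} {S β : Mat 𝕜 n} (h : IsLift v S β) :
    P₁ S β ∈ tangentS 𝕜 n := P₁_mem_tangentS hn h.1 h.2.1

theorem P₀_mem_tangentS {S β : Mat 𝕜 n} (ht : β.trace = 0) : P₀ S β ∈ tangentS 𝕜 n := ⟨β, ht, rfl⟩

theorem add_matA_row {M : Mat 𝕜 n} (hM : ∀ i : Fin n, M i.castSucc = Pi.single i.succ 1) (lam : 𝕜)
    (i : Fin n) : (M + lam • matA 𝕜 n) i.castSucc = Pi.single i.succ 1 := by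
  rw [← hM i]
  funext j
  simp [matA, (Fin.castSucc_lt_last i).ne']

theorem IsTransversalLift.last {lam : 𝕜} {u v : Fin n → Loop 𝕜} {V : Mat 𝕜 n}
    (h : IsTransversalLift lam u v V) (j : Fin n) : V j.castSucc (Fin.last n) = v j := by
  have := eq_of_redPairing fun w => (matPairing_lastRow V w).symm.trans (h.2.2 w)
  exact congrFun this j

theorem IsTransversalLift.P₁_mem (hn : 1 ≤ n) {lam : 𝕜} {u v : Fin n → Loop 𝕜} {V : Mat 𝕜 n}
    (h : IsTransversalLift lam u v V) : P₁ (pointQ u) V ∈ tangentS 𝕜 n := by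
  obtain ⟨ht, ⟨w, hw⟩, -⟩ := h
  rw [pencil_eq, sub_eq_iff_eq_add] at hw
  have h0 := (mem_tangentS hn).1 (P₀_mem_tangentS (S := pointQ u) ht)
  refine (mem_tangentS hn).2 ⟨fun i j => ?_, trace_P₁ _ ht⟩
  rw [hw, Matrix.add_apply, lastRow_apply_castSucc, Matrix.smul_apply, h0.1, smul_zero, zero_add]

/-- Row `i` of `Q + λA` is a basis row, so row `i` of the tangency condition expresses the next row
of `V` as a covariant derivative. -/
theorem IsTransversalLift.row_succ {lam : 𝕜} {u v : Fin n → Loop 𝕜} {V : Mat 𝕜 n}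
    (h : IsTransversalLift lam u v V) (i : Fin n) :
    V i.succ = cov (pointQ u + lam • matA 𝕜 n) (V i.castSucc) := by
  obtain ⟨-, ⟨w, hw⟩, -⟩ := h
  have hrow := add_matA_row (pointQ_row u) lam
  funext j
  have h1 := congrFun (congrFun hw i.castSucc) j
  have h2 : ((pointQ u + lam • matA 𝕜 n) * V) i.castSucc j = V i.succ j := by
    change Matrix.vecMul ((pointQ u + lam • matA 𝕜 n) i.castSucc) V j = _
    rw [hrow, Matrix.single_one_vecMul]
    rfl
  rw [pencil_eq_P₁, P₁_apply, lastRow_apply_castSucc, h2, sub_eq_zero] at h1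
  exact h1.symm

/-- Two covectors at a point of the transversal submanifold that both annihilate `D` and have the
same restriction to the submanifold differ by a strictly lower triangular matrix. -/
theorem strictLower_sub {u : Fin n → Loop 𝕜} {V W : Mat 𝕜 n} (hn : 1 ≤ n)
    (hV : V.trace = 0) (hW : W.trace = 0) (hV1 : P₁ (pointQ u) V ∈ tangentS 𝕜 n)
    (hW1 : P₁ (pointQ u) W ∈ tangentS 𝕜 n)
    (h : ∀ j : Fin n, V j.castSucc (Fin.last n) = W j.castSucc (Fin.last n)) :
    StrictLower (V - W) := by
  refine strictLower_of_P₁ (isHessenberg_of_row (pointQ_row u))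
    (by rw [Matrix.trace_sub, hV, hW, sub_zero]) (fun i => by rw [Matrix.sub_apply, h, sub_self])
    fun i j => ?_
  rw [P₁_sub, Matrix.sub_apply, ((mem_tangentS hn).1 hV1).1, ((mem_tangentS hn).1 hW1).1, sub_zero]

/-- The spectral parameters may differ: the term with `A` only contributes a vector tangent to the
leaf. In consequence the first row and the last column of a lift do not depend on the parameter. -/
theorem IsTransversalLift.strictLower_sub (hn : 1 ≤ n) {lam mu : 𝕜} {u v : Fin n → Loop 𝕜}
    {V W : Mat 𝕜 n} (hV : IsTransversalLift lam u v V) (hW : IsTransversalLift mu u v W) :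
    StrictLower (V - W) :=
  GelfandDickey.strictLower_sub hn hV.1 hW.1 (hV.P₁_mem hn) (hW.P₁_mem hn) fun j => by
    rw [hV.last, hW.last]

theorem IsTransversalLift.unique (hn : 1 ≤ n) {lam : 𝕜} {u v : Fin n → Loop 𝕜}
    {V W : Mat 𝕜 n} (hV : IsTransversalLift lam u v V) (hW : IsTransversalLift lam u v W) :
    V = W := by
  have h0 := (hV.strictLower_sub hn hW).apply_zero
  ext1 i j
  have hrow : V i = W i := by
    induction i using Fin.induction with
    | zero => exact funext fun j => sub_eq_zero.1 (h0 j)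
    | succ i ih => rw [hV.row_succ, hW.row_succ, ih]
  rw [hrow]

/-! ### Existence of transversal lifts -/

/-- The entries of the `k`-th column from the right of a transversal lift with last column `c`. -/
def liftColumn (q : ℕ → Loop 𝕜) (c : ℕ → Loop 𝕜) : ℕ → ℕ → Loop 𝕜
  | 0, i => c i
  | k + 1, i => liftColumn q c k (i + 1) - (liftColumn q c k i)′ - c i * q k

/-- The entry depends on `c (i + k)` only by adding it, the other data being `c l` with `l < i + k`.
On the diagonal `i + k = n`, so the free corner shifts all diagonal entries equally. -/
theorem liftColumn_sub (q : ℕ → Loop 𝕜) {c c' : ℕ → Loop 𝕜} (k : ℕ) :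
    ∀ i, (∀ l < i + k, c l = c' l) →
      liftColumn q c k i - liftColumn q c' k i = c (i + k) - c' (i + k) := by
  induction k with
  | zero => exact fun i _ => rfl
  | succ k ih =>
    intro i h
    have h1 := ih (i + 1) fun l hl => h l (by omega)
    have h2 := ih i fun l hl => h l (by omega)
    rw [h (i + k) (by omega), sub_self, sub_eq_zero] at h2
    simp only [liftColumn]
    rw [h2, h i (by omega), sub_sub_sub_cancel_right, sub_sub_sub_cancel_right, h1]
    congr 2 <;> ring

theorem exists_isTransversalLift (hn : 1 ≤ n) (lam : 𝕜) (u v : Fin n → Loop 𝕜) :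
    ∃ V, IsTransversalLift lam u v V := by
  set M := pointQ u + lam • matA 𝕜 n with hM
  have hrow := add_matA_row (pointQ_row u) lam
  have hHess := isHessenberg_of_row hrow
  let q : ℕ → Loop 𝕜 := fun k => if h : k ≤ n then M (Fin.last n) ⟨n - k, by omega⟩ else 0
  let c₀ : ℕ → Loop 𝕜 := fun i => if h : i < n then v ⟨i, h⟩ else 0
  -- The bottom right entry is the only freedom left by `v`. With provisional value zero the
  -- diagonal has some trace; as the corner is added to all `n + 1` diagonal entries, this value
  -- cancels it.
  let z : Loop 𝕜 := -((n + 1 : 𝕜)⁻¹ • ∑ i : Fin (n + 1), liftColumn q c₀ (n - i.val) i.val)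
  let c : ℕ → Loop 𝕜 := fun i => if h : i < n then v ⟨i, h⟩ else z
  let row : ℕ → Fin (n + 1) → Loop 𝕜 := fun i =>
    Nat.rec (fun j => liftColumn q c (n - j.val) 0) (fun _ y => cov M y) i
  have hrow1 : ∀ i, row (i + 1) = cov M (row i) := fun i => rfl
  -- On and above the diagonal the rows generated by covariant derivatives agree with the column
  -- recursion; the last column is therefore the prescribed one.
  have hup : ∀ i, ∀ j : Fin (n + 1), i ≤ j.val → row i j = liftColumn q c (n - j.val) i := by
    intro i
    induction i with
    | zero => exact fun j _ => rfl
    | succ i ih =>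
      intro j hj
      obtain ⟨j, rfl⟩ := exists_succ (i := j) (by rintro rfl; simp at hj)
      simp only [Fin.val_succ] at hj
      have hjn := j.isLt
      rw [hrow1, cov, hHess.vecMul, ih j.succ (by simp; omega), ih j.castSucc (by simp; omega),
        ih (Fin.last n) (by simp; omega)]
      have e1 : n - j.castSucc.val = (n - j.succ.val) + 1 := by simp; omega
      have e2 : n - (Fin.last n).val = 0 := by simp
      have e3 : q (n - j.succ.val) = M (Fin.last n) j.succ := by
        have : n - j.succ.val ≤ n := by omega
        simp only [q, this, dif_pos]
        congr 1
        exact Fin.ext (by simp; omega)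
      rw [e1, e2, liftColumn, liftColumn, e3]
      ring
  let V : Mat 𝕜 n := Matrix.of fun i => row i.val
  have hlast : ∀ j : Fin n, V j.castSucc (Fin.last n) = v j := by
    intro j
    change row j.val (Fin.last n) = v j
    rw [hup _ _ (by simp)]
    simp [liftColumn, c]
  have hcz : ∀ l, l < n → c l = c₀ l := fun l hl => by simp [c, c₀, hl]
  have hdiag : ∀ i : Fin (n + 1), V i i = liftColumn q c₀ (n - i.val) i.val + z := by
    intro i
    have hi := i.isLt
    have h1 := liftColumn_sub q (c := c) (c' := c₀) (n - i.val) i.val fun l hl => hcz l (by omega)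
    rw [show i.val + (n - i.val) = n by omega] at h1
    have h2 : c n - c₀ n = z := by simp [c, c₀]
    rw [h2, sub_eq_iff_eq_add'] at h1
    rw [← h1]
    exact hup _ _ le_rfl
  have htr : V.trace = 0 := by
    have hn1 : (n + 1 : 𝕜) ≠ 0 := by exact_mod_cast Nat.succ_ne_zero n
    have e : ((n + 1 : ℕ) : Loop 𝕜) = algebraMap 𝕜 (Loop 𝕜) (n + 1 : 𝕜) := by simp
    rw [Matrix.trace, Finset.sum_congr rfl fun i _ => (Matrix.diag_apply V i).trans (hdiag i),
      Finset.sum_add_distrib, Finset.sum_const, Finset.card_univ, Fintype.card_fin, nsmul_eq_mul,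
      e, smul_algebraMap_mul, smul_neg, smul_smul, mul_inv_cancel₀ hn1, one_smul, add_neg_cancel]
  refine ⟨V, htr, ⟨_, eq_lastRow (fun i j => ?_) ?_⟩, fun w => ?_⟩
  · have h2 : (M * V) i.castSucc j = V i.succ j := by
      change Matrix.vecMul (M i.castSucc) V j = _
      rw [hM, hrow, Matrix.single_one_vecMul]
      rfl
    rw [pencil_eq_P₁, P₁_apply, h2, sub_eq_zero]
    exact (congrFun (hrow1 i.val) j).symm
  · exact trace_P₁ _ htr
  · rw [matPairing_lastRow]
    congr 1
    exact funext hlast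

theorem frame_pointQ (u : Fin n → Loop 𝕜) : frame (pointQ u) = 1 := frame_of_row (pointQ_row u)

theorem exists_lastRow_dInvariants_pointQ (hn : 1 ≤ n) (u : Fin n → Loop 𝕜) {Y : Mat 𝕜 n}
    (hY : Y ∈ tangentS 𝕜 n) : ∃ W : Mat 𝕜 n, StrictLower W ∧
      lastRow (dInvariants (pointQ u) Y) = P₁ (pointQ u) W + Y := by
  have h := exists_lastRow_dInvariants hn (pointQ_mem_leafS hn u) hY
  simpa only [frob_of_row (pointQ_row u), frame_pointQ, inv_one, one_mul, mul_one] using h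

theorem dInvariants_pointQ_eq (hn : 1 ≤ n) (u : Fin n → Loop 𝕜) {Y W : Mat 𝕜 n}
    (hY : Y ∈ tangentS 𝕜 n) (hW : StrictLower W) {w : Fin n → Loop 𝕜}
    (h : lastRow w = P₁ (pointQ u) W + Y) : dInvariants (pointQ u) Y = w := by
  refine dInvariants_eq hn (pointQ_mem_leafS hn u) hY hW ?_
  rw [frob_of_row (pointQ_row u), frame_pointQ, inv_one, one_mul, mul_one, h]

/-- Skewness of `P₁` turns tangency of `P₁ V` to the leaf into annihilation of `D`. A tangent vector
of the leaf and its projection to the transversal differ by an element of `D`, so the pairing is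
determined on the transversal. -/
theorem IsTransversalLift.isLift (hn : 1 ≤ n) {lam : 𝕜} {u v : Fin n → Loop 𝕜} {V : Mat 𝕜 n}
    (h : IsTransversalLift lam u v V) : IsLift v (pointQ u) V := by
  have hD : ∀ Y ∈ distD (pointQ u), matPairing V Y = 0 := by
    rintro Y ⟨W, -, hW, rfl⟩
    rw [matPairing_P₁, matPairing_of_mem_tangentS (h.P₁_mem hn) hW, neg_zero]
  refine ⟨h.1, hD, fun Y hY w hw => ?_⟩
  rw [tangentProj_iff hn (pointQ_mem_leafS hn u) hY] at hw
  obtain ⟨W, hW, e⟩ := exists_lastRow_dInvariants_pointQ hn u hY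
  rw [hw, ← h.2.2, e, matPairing_add_right, hD _ (hW.P₁_mem_distD _), zero_add]

/-! ### The reduced tensors -/

/-- Only the last column and the first row of `T` meet `A`, and for a unitriangular matrix both are
basis vectors. -/
theorem matA_conj {T : Mat 𝕜 n} (hT : UniLower T) : T * matA 𝕜 n = matA 𝕜 n * T := by
  ext1 i j
  have h1 : (T * matA 𝕜 n) i j = if j = 0 then T i (Fin.last n) else 0 := by
    rw [matA]
    split_ifs with h
    · subst h; simp
    · simp [h]
  have h2 : (matA 𝕜 n * T) i j = if i = Fin.last n then T 0 j else 0 := by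
    rw [matA]
    split_ifs with h
    · subst h; simp
    · simp [h]
  have h3 : ∀ i, T i (Fin.last n) = if i = Fin.last n then 1 else 0 := by
    intro i
    rcases (Fin.le_last i).eq_or_lt with rfl | h
    · simp [hT.apply_self]
    · simp [hT.apply_of_lt h, h.ne]
  rw [h1, h2, h3, hT.row_zero, Pi.single_apply]
  split_ifs <;> rfl

theorem P₀_conj {T V S Q : Mat 𝕜 n} (hT : UniLower T) :
    P₀ Q (T * V * T⁻¹) = T * P₀ S V * T⁻¹ := by
  have h : matA 𝕜 n * T⁻¹ = T⁻¹ * matA 𝕜 n := by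
    refine hT.mul_right_cancel ?_
    rw [mul_assoc, hT.inv_mul, mul_assoc, ← matA_conj hT, ← mul_assoc, hT.inv_mul, mul_one, one_mul]
  rw [P₀_eq, P₀_eq, mul_sub, sub_mul, mul_assoc (T * V), ← h, ← mul_assoc, ← mul_assoc,
    ← matA_conj hT]
  simp only [mul_assoc]

theorem trace_conj {T V : Mat 𝕜 n} (hT : UniLower T) : (T * V * T⁻¹).trace = V.trace := by
  rw [mul_assoc, Matrix.trace_mul_comm, hT.inv_mul_cancel_right]

theorem conj_mem_tangentS {T Y : Mat 𝕜 n} (hT : UniLower T) (hY : Y ∈ tangentS 𝕜 n) :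
    T * Y * T⁻¹ ∈ tangentS 𝕜 n := by
  obtain ⟨V, hV, rfl⟩ := hY
  exact ⟨T * V * T⁻¹, by rw [trace_conj hT, hV], P₀_conj (S := 0) (Q := 0) hT⟩

theorem conj_inv_mem_tangentS {T Y : Mat 𝕜 n} (hT : UniLower T) (hY : Y ∈ tangentS 𝕜 n) :
    T⁻¹ * Y * T ∈ tangentS 𝕜 n := by
  obtain ⟨V, hV, rfl⟩ := hY
  refine ⟨T⁻¹ * V * T, by rw [Matrix.trace_mul_comm, ← mul_assoc, hT.mul_inv, one_mul, hV], ?_⟩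
  have h := P₀_conj (S := 0) (Q := 0) (V := T⁻¹ * V * T) hT
  have e : T * (T⁻¹ * V * T) * T⁻¹ = V := by
    rw [← mul_assoc, ← mul_assoc, hT.mul_inv, one_mul, mul_assoc, hT.mul_inv, mul_one]
  rw [e] at h
  change P₀ 0 (T⁻¹ * V * T) = T⁻¹ * P₀ 0 V * T
  rw [h]
  generalize P₀ 0 (T⁻¹ * V * T) = X
  rw [mul_assoc, hT.inv_mul_cancel_right, ← mul_assoc, hT.inv_mul, one_mul]

/-- The conjugate of a lift by the frame restricts to the covector on the transversal
submanifold. -/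
theorem IsLift.conj_last (hn : 1 ≤ n) {v : Fin n → Loop 𝕜} {S β : Mat 𝕜 n} (hS : S ∈ leafS 𝕜 n)
    (h : IsLift v S β) (j : Fin n) :
    (frame S * β * (frame S)⁻¹) j.castSucc (Fin.last n) = v j := by
  have hT := ((mem_leafS hn).1 hS).1.uniLower_frame
  refine congrFun (eq_of_redPairing (v := fun j => (frame S * β * (frame S)⁻¹) j.castSucc _)
    (v' := v) fun w => ?_) j
  rw [← matPairing_lastRow]
  have hY := conj_inv_mem_tangentS hT (lastRow_mem_tangentS hn w)
  have e : frame S * ((frame S)⁻¹ * lastRow w * frame S) * (frame S)⁻¹ = lastRow w := by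
    rw [← mul_assoc, ← mul_assoc, hT.mul_inv, one_mul, mul_assoc, hT.mul_inv, mul_one]
  have hw : dInvariants S ((frame S)⁻¹ * lastRow w * frame S) = w :=
    dInvariants_eq hn hS hY strictLower_zero (by rw [P₁_zero, zero_add, e])
  rw [← h.2.2 _ hY w ((tangentProj_iff hn hS hY).2 hw.symm), matPairing, matPairing]
  congr 1
  rw [mul_assoc, Matrix.trace_mul_comm, mul_assoc, Matrix.trace_mul_comm β]
  simp only [mul_assoc]

/-- The image of a covector under a tensor projects to a vector which does not depend on the
lift. -/
theorem dInvariants_lift (hn : 1 ≤ n) {v : Fin n → Loop 𝕜} {S β V : Mat 𝕜 n} (hS : S ∈ leafS 𝕜 n)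
    (hβ : IsLift v S β) {lam : 𝕜} (hV : IsTransversalLift lam (invariants S) v V) :
    dInvariants S (P₀ S β) = dInvariants (pointQ (invariants S)) (P₀ (pointQ (invariants S)) V) ∧
    dInvariants S (P₁ S β) =
      dInvariants (pointQ (invariants S)) (P₁ (pointQ (invariants S)) V) := by
  have hH := ((mem_leafS hn).1 hS).1
  have hT := hH.uniLower_frame
  have hfr := frob_eq_pointQ hn hS
  have hP1 := P₁_conj (V := β) hT hH.frob_mul_frame
  have hP0 := P₀_conj (V := β) (S := S) (Q := frob S) hT
  rw [hfr] at hP1 hP0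
  -- Both covectors are compared at the normal form. Their difference is invisible to `P₀`, and
  -- under `P₁` it is absorbed into the strictly lower triangular matrix allowed by
  -- `dInvariants_eq`.
  have hη : StrictLower (V - frame S * β * (frame S)⁻¹) := by
    refine strictLower_sub (u := invariants S) hn hV.1 (by rw [trace_conj hT, hβ.1])
      (hV.P₁_mem hn) ?_ fun j => ?_
    · rw [hP1]
      exact conj_mem_tangentS hT (hβ.P₁_mem hn)
    · rw [hV.last, hβ.conj_last hn hS]
  constructor
  · obtain ⟨W, hW, e⟩ := exists_lastRow_dInvariants_pointQ hn (invariants S)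
      (P₀_mem_tangentS (S := pointQ (invariants S)) hV.1)
    refine dInvariants_eq hn hS (P₀_mem_tangentS hβ.1) hW ?_
    have h0 := hη.P₀_eq_zero (pointQ (invariants S))
    rw [P₀_sub, sub_eq_zero] at h0
    rw [e, h0, hP0, hfr]
  · obtain ⟨W, hW, e⟩ := exists_lastRow_dInvariants_pointQ hn (invariants S) (hV.P₁_mem hn)
    refine dInvariants_eq hn hS (hβ.P₁_mem hn) (hW.add hη) ?_
    rw [e, P₁_add, P₁_sub, hfr, ← hP1]
    abel

theorem IsReducedTensor.unique (hn : 1 ≤ n) {P : Mat 𝕜 n → Mat 𝕜 n → Mat 𝕜 n}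
    {T T' : (Fin n → Loop 𝕜) → (Fin n → Loop 𝕜) → (Fin n → Loop 𝕜)} (h : IsReducedTensor P T)
    (h' : IsReducedTensor P T') : T = T' := by
  funext u v
  obtain ⟨V, hV⟩ := exists_isTransversalLift hn (0 : 𝕜) u v
  have hQ := pointQ_mem_leafS hn u
  have hproj : Proj (pointQ u) u := (proj_iff hn hQ).2 (invariants_pointQ u).symm
  obtain ⟨h1, h2⟩ := h u v _ V hQ hproj (hV.isLift hn)
  obtain ⟨-, h3⟩ := h' u v _ V hQ hproj (hV.isLift hn)
  rw [tangentProj_iff hn hQ h1] at h2 h3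
  rw [h2, h3]

/-- The lift at spectral parameter zero. -/
def transversalLift (hn : 1 ≤ n) (u v : Fin n → Loop 𝕜) : Mat 𝕜 n :=
  (exists_isTransversalLift hn (0 : 𝕜) u v).choose

theorem transversalLift_spec (hn : 1 ≤ n) (u v : Fin n → Loop 𝕜) :
    IsTransversalLift (0 : 𝕜) u v (transversalLift hn u v) :=
  (exists_isTransversalLift hn (0 : 𝕜) u v).choose_spec

/-- The reduction of `P₀`. -/
def redTensor₀ (hn : 1 ≤ n) (u v : Fin n → Loop 𝕜) : Fin n → Loop 𝕜 :=
  dInvariants (pointQ u) (P₀ (pointQ u) (transversalLift hn u v))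

/-- The reduction of `P₁`. -/
def redTensor₁ (hn : 1 ≤ n) (u v : Fin n → Loop 𝕜) : Fin n → Loop 𝕜 :=
  dInvariants (pointQ u) (P₁ (pointQ u) (transversalLift hn u v))

theorem isReducedTensor₀ (hn : 1 ≤ n) : IsReducedTensor (P₀ (𝕜 := 𝕜)) (redTensor₀ hn) := by
  intro u v S β hS hu hβ
  rw [proj_iff hn hS] at hu
  subst hu
  have hm := P₀_mem_tangentS (S := S) hβ.1
  exact ⟨hm, (tangentProj_iff hn hS hm).2
    (dInvariants_lift hn hS hβ (transversalLift_spec hn _ v)).1.symm⟩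

theorem isReducedTensor₁ (hn : 1 ≤ n) : IsReducedTensor (P₁ (𝕜 := 𝕜)) (redTensor₁ hn) := by
  intro u v S β hS hu hβ
  rw [proj_iff hn hS] at hu
  subst hu
  have hm := hβ.P₁_mem hn
  exact ⟨hm, (tangentProj_iff hn hS hm).2
    (dInvariants_lift hn hS hβ (transversalLift_spec hn _ v)).2.symm⟩

theorem lastRow_sub_smul (lam : 𝕜) (v w : Fin n → Loop 𝕜) :
    lastRow (v - lam • w) = lastRow v - lam • lastRow w := by
  ext1 i j
  refine Fin.lastCases ?_ (fun i => ?_) i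
  · refine Fin.lastCases ?_ (fun j => ?_) j
    · simp [lastRow_apply_last_last]
    · simp [lastRow_apply_last]
  · simp [lastRow_apply_castSucc]

theorem P₁_smul (S V : Mat 𝕜 n) (lam : 𝕜) : P₁ S (lam • V) = lam • P₁ S V := by
  have : mderiv (lam • V) = lam • mderiv V := by
    ext1 i j
    exact loop_deriv_smul lam (V i j)
  rw [P₁_eq, P₁_eq, this, Matrix.smul_mul, Matrix.mul_smul, smul_add, smul_sub]

theorem sub_smul_mem_tangentS (hn : 1 ≤ n) {X Y : Mat 𝕜 n} (hX : X ∈ tangentS 𝕜 n)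
    (hY : Y ∈ tangentS 𝕜 n) (lam : 𝕜) : X - lam • Y ∈ tangentS 𝕜 n := by
  rw [mem_tangentS hn] at *
  refine ⟨fun i j => ?_, ?_⟩
  · rw [Matrix.sub_apply, Matrix.smul_apply, hX.1, hY.1, smul_zero, sub_zero]
  · rw [Matrix.trace_sub, Matrix.trace_smul, hX.2, hY.2, smul_zero, sub_zero]

theorem StrictLower.smul {N : Mat 𝕜 n} (h : StrictLower N) (lam : 𝕜) : StrictLower (lam • N) :=
  fun i j hij => by rw [Matrix.smul_apply, h i j hij, smul_zero]

theorem dInvariants_sub_smul (hn : 1 ≤ n) {S X Y : Mat 𝕜 n} (hS : S ∈ leafS 𝕜 n)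
    (hX : X ∈ tangentS 𝕜 n) (hY : Y ∈ tangentS 𝕜 n) (lam : 𝕜) :
    dInvariants S (X - lam • Y) = dInvariants S X - lam • dInvariants S Y := by
  obtain ⟨W, hW, e⟩ := exists_lastRow_dInvariants hn hS hX
  obtain ⟨W', hW', e'⟩ := exists_lastRow_dInvariants hn hS hY
  refine dInvariants_eq hn hS (sub_smul_mem_tangentS hn hX hY lam) (hW.sub (hW'.smul lam)) ?_
  rw [lastRow_sub_smul, e, e', P₁_sub, P₁_smul, mul_sub, sub_mul, Matrix.mul_smul, Matrix.smul_mul]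
  module

theorem isReducedTensor_pencil (hn : 1 ≤ n) (lam : 𝕜) : IsReducedTensor (pencil (n := n) lam)
    fun u v => redTensor₁ hn u v - lam • redTensor₀ hn u v := by
  intro u v S β hS hu hβ
  obtain ⟨h0, h0'⟩ := isReducedTensor₀ hn u v S β hS hu hβ
  obtain ⟨h1, h1'⟩ := isReducedTensor₁ hn u v S β hS hu hβ
  have hm := sub_smul_mem_tangentS hn h1 h0 lam
  rw [pencil_eq]
  refine ⟨hm, (tangentProj_iff hn hS hm).2 ?_⟩
  rw [dInvariants_sub_smul hn hS h1 h0, ← (tangentProj_iff hn hS h0).1 h0',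
    ← (tangentProj_iff hn hS h1).1 h1']

/-- The pencil vector is already tangent to the transversal, where the differential of `π` just
reads off components. -/
theorem IsTransversalLift.pencil_eq_lastRow (hn : 1 ≤ n) {lam : 𝕜} {u v : Fin n → Loop 𝕜}
    {V : Mat 𝕜 n} (h : IsTransversalLift lam u v V) :
    pencil lam (pointQ u) V = lastRow (redTensor₁ hn u v - lam • redTensor₀ hn u v) := by
  obtain ⟨w, hw⟩ := h.2.1
  have hQ := pointQ_mem_leafS hn u
  obtain ⟨h1, h2⟩ := isReducedTensor_pencil hn lam u v _ V hQ
    ((proj_iff hn hQ).2 (invariants_pointQ u).symm) (h.isLift hn)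
  rw [tangentProj_iff hn hQ h1] at h2
  refine Eq.trans ?_ (congrArg lastRow h2.symm)
  rw [hw, dInvariants_pointQ_eq hn u (lastRow_mem_tangentS hn w) strictLower_zero]
  rw [P₁_zero, zero_add]

end Lifts

/-! ## The Adler–Gel'fand–Dickey form of the reduced tensors -/

section Operators

variable {𝕜 : Type*} [RCLike 𝕜] {n : ℕ}

attribute [local instance] psiDORing

theorem adlerTrace_sum {ι : Type*} (s : Finset ι) (A : ι → PsiDO (Loop 𝕜)) :
    adlerTrace (∑ i ∈ s, A i) = ∑ i ∈ s, adlerTrace (A i) := by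
  rw [adlerTrace, res, sum_coeff, loopIntegral_sum]
  rfl

theorem IsTransversalLift.adlerTrace_eq {lam : 𝕜} {u v : Fin n → Loop 𝕜} {V : Mat 𝕜 n}
    (h : IsTransversalLift lam u v V) (w : Fin n → Loop 𝕜) :
    adlerTrace (opX V * opLdot w) = redPairing v w := by
  have e : opX V * opLdot w = ∑ a : Fin (n + 1), ∑ j : Fin n,
      mono 1 (-(a.val : ℤ) - 1) * mono (V a (Fin.last n) * w j) (j.val : ℤ) := by
    rw [opX, opLdot, neg_mul_neg, Finset.sum_mul_sum]
    simp only [mul_assoc, fun_mul_mono]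
  rw [e]
  simp only [adlerTrace_sum, res_mono_mul_mono]
  rw [Finset.sum_comm, redPairing]
  refine Finset.sum_congr rfl fun j _ => ?_
  rw [Finset.sum_eq_single j.castSucc]
  · rw [Fin.val_castSucc, if_pos rfl, h.last]
  · intro a _ ha
    exact if_neg fun h' => ha (Fin.ext h')
  · simp

theorem rowOp_lastRow (w : Fin n → Loop 𝕜) :
    rowOp (lastRow w (Fin.last n)) = ∑ j : Fin n, mono (w j) (j.val : ℤ) := by
  rw [rowOp, Fin.sum_univ_castSucc]
  simp only [lastRow_apply_last, lastRow_apply_last_last, mono_zero, add_zero, Fin.val_castSucc]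

theorem opLdot_eq (w : Fin n → Loop 𝕜) : opLdot w = -rowOp (lastRow w (Fin.last n)) := by
  rw [rowOp_lastRow, opLdot]

theorem opL_eq (u : Fin n → Loop 𝕜) :
    opL u = mono 1 ((n : ℤ) + 1) - rowOp (lastRow u (Fin.last n)) := by
  rw [rowOp_lastRow, opL]

/-- The entry of `λA` sits in the column of `u_0`, so it shifts the operator by the constant `λ`. -/
theorem opL_sub (u : Fin n → Loop 𝕜) (lam : 𝕜) :
    mono 1 ((n : ℤ) + 1) - rowOp ((pointQ u + lam • matA 𝕜 n) (Fin.last n)) =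
      opL u - mono (algebraMap 𝕜 (Loop 𝕜) lam) 0 := by
  have h : (pointQ u + lam • matA 𝕜 n) (Fin.last n) =
      lastRow u (Fin.last n) + algebraMap 𝕜 (Loop 𝕜) lam • Pi.single 0 1 := by
    funext j
    have hA : matA 𝕜 n (Fin.last n) j = (Pi.single 0 1 : Fin (n + 1) → Loop 𝕜) j := by
      rw [matA, Matrix.single_apply, Pi.single_apply]
      simp [eq_comm]
    rw [Matrix.add_apply, Matrix.smul_apply, pointQ_last, hA, Pi.add_apply, Pi.smul_apply,
      smul_eq_mul, smul_algebraMap_mul]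
  rw [h, rowOp_add, rowOp_smul, rowOp_single, fun_mul_mono, mul_one, opL_eq, sub_add_eq_sub_sub]
  rfl

theorem ordLE_opX (V : Mat 𝕜 n) : OrdLE (opX V) (-1) := ordLE_colOp fun j => V j (Fin.last n)

theorem ordLE_opL (u : Fin n → Loop 𝕜) : OrdLE (opL u) ((n : ℤ) + 1) := by
  rw [opL_eq]
  exact (ordLE_mono _ _).sub ((ordLE_rowOp _).mono (by omega))

theorem exists_inverse_opL (u : Fin n → Loop 𝕜) :
    ∃ M, IsInverse (opL u) M ∧ OrdLE M (-((n : ℤ) + 1)) := by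
  refine exists_inverse_of_monic ?_
  rw [opL_eq, sub_sub_cancel]
  exact (ordLE_rowOp _).mono (by omega)

/-- The operator identities satisfied by a transversal lift, for each spectral parameter. -/
theorem IsTransversalLift.operators (hn : 1 ≤ n) {lam : 𝕜} {u v : Fin n → Loop 𝕜} {V : Mat 𝕜 n}
    (h : IsTransversalLift lam u v V) :
    opE V = plus (opX V * opL u) ∧
    opLdot (redTensor₁ hn u v - lam • redTensor₀ hn u v) =
      (opL u - mono (algebraMap 𝕜 (Loop 𝕜) lam) 0) * opE V -
        plus (opL u * opX V) * (opL u - mono (algebraMap 𝕜 (Loop 𝕜) lam) 0) := by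
  set M := pointQ u + lam • matA 𝕜 n with hM
  have hrow := add_matA_row (pointQ_row u) lam
  let y : ℕ → Fin (n + 1) → Loop 𝕜 := fun k => Nat.rec (V 0) (fun _ y => cov M y) k
  have hy : ∀ k, y (k + 1) = cov M (y k) := fun k => rfl
  have hyV : ∀ i : Fin (n + 1), y i.val = V i := by
    intro i
    induction i using Fin.induction with
    | zero => rfl
    | succ i ih =>
      rw [h.row_succ, ← ih]
      rfl
  have hc : ∀ k : Fin (n + 1), y k (Fin.last n) = V k (Fin.last n) := fun k => by rw [hyV]
  have hL := opL_sub u lam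
  rw [← hM] at hL
  -- The last row of the pencil equation: one covariant derivative beyond the last row of `V`.
  have hw : y (n + 1) = lastRow (redTensor₁ hn u v - lam • redTensor₀ hn u v) (Fin.last n) +
      ∑ k : Fin (n + 1), M (Fin.last n) k • y k := by
    have h1 := h.pencil_eq_lastRow hn
    rw [pencil_eq_P₁, ← hM] at h1
    funext j
    have hyn : y n = V (Fin.last n) := hyV (Fin.last n)
    rw [← h1, Pi.add_apply, P₁_apply, hy, hyn, Matrix.mul_apply, Finset.sum_apply]
    simp only [hyV, Pi.smul_apply, smul_eq_mul, sub_add_cancel]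
  have hE := neg_rowOp_eq_plus hrow hy hc
  have hT := neg_rowOp_eq hrow hy hc hw
  rw [← hM, hL] at hE hT
  have hEV : -rowOp (y 0) = opE V := rfl
  have hXV : colOp (fun k => V k (Fin.last n)) = opX V := rfl
  have hX1 := ordLE_opX V
  have hc0 := ordLE_mono (algebraMap 𝕜 (Loop 𝕜) lam) 0
  rw [hEV, hXV] at hE hT
  constructor
  -- `λ` drops out of the differential part because `X` times a constant still has negative order.
  · rw [hE, mul_sub, plus_sub, plus_eq_zero ((hX1.mul hc0).mono (by omega)), sub_zero]
  · rw [opLdot_eq, hT, sub_mul _ _ (opX V), plus_sub, plus_eq_zero ((hc0.mul hX1).mono (by omega)),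
      sub_zero]

theorem opX_congr {V W : Mat 𝕜 n} (h : StrictLower (V - W)) : opX V = opX W := by
  have : ∀ j, V j (Fin.last n) = W j (Fin.last n) := fun j => sub_eq_zero.1 (h.apply_last j)
  simp only [opX, this]

theorem opE_congr {V W : Mat 𝕜 n} (h : StrictLower (V - W)) : opE V = opE W := by
  have : ∀ j, V 0 j = W 0 j := fun j => sub_eq_zero.1 (h.apply_zero j)
  simp only [opE, this]

theorem opLdot_sub (v w : Fin n → Loop 𝕜) : opLdot (v - w) = opLdot v - opLdot w := by
  have h := lastRow_sub_smul (1 : 𝕜) v w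
  rw [one_smul, one_smul] at h
  have hr : lastRow v (Fin.last n) =
      lastRow (v - w) (Fin.last n) + lastRow w (Fin.last n) := by
    rw [h]
    exact (sub_add_cancel (lastRow v (Fin.last n)) (lastRow w (Fin.last n))).symm
  rw [opLdot_eq, opLdot_eq, opLdot_eq, hr, rowOp_add]
  abel

/-- `E` and `X` are common to all parameters, so the identity at `λ = 0` gives the first tensor and
its difference from `λ = 1` the other. -/
theorem IsTransversalLift.opLdot_eq (hn : 1 ≤ n) {lam : 𝕜} {u v : Fin n → Loop 𝕜} {V : Mat 𝕜 n}
    (h : IsTransversalLift lam u v V) :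
    opLdot (redTensor₁ hn u v) = opL u * opE V - plus (opL u * opX V) * opL u ∧
    opLdot (redTensor₀ hn u v) = opE V - plus (opL u * opX V) := by
  obtain ⟨V₀, h₀⟩ := exists_isTransversalLift hn (0 : 𝕜) u v
  obtain ⟨V₁, h₁⟩ := exists_isTransversalLift hn (1 : 𝕜) u v
  have e0 := (h₀.operators hn).2
  have e1 := (h₁.operators hn).2
  rw [map_zero, mono_zero, sub_zero, zero_smul, sub_zero, ← opX_congr (h.strictLower_sub hn h₀),
    ← opE_congr (h.strictLower_sub hn h₀)] at e0
  rw [map_one, one_smul, ← opX_congr (h.strictLower_sub hn h₁),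
    ← opE_congr (h.strictLower_sub hn h₁), opLdot_sub, e0,
    show (mono (1 : Loop 𝕜) 0 : PsiDO (Loop 𝕜)) = 1 from rfl, sub_mul, mul_sub, one_mul,
    mul_one] at e1
  refine ⟨e0, ?_⟩
  rw [sub_eq_iff_eq_add, ← sub_eq_iff_eq_add'] at e1
  rw [← e1]
  abel

/-- `E` is `X L` minus its part of negative order. Conjugating that part by `L` keeps its order
negative, since the orders of `L` and `L⁻¹` cancel. -/
theorem plus_conj (u : Fin n → Loop 𝕜) {V : Mat 𝕜 n} {M : PsiDO (Loop 𝕜)}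
    (hE : opE V = plus (opX V * opL u)) (hM : IsInverse (opL u) M)
    (hord : OrdLE M (-((n : ℤ) + 1))) :
    plus (opL u * opE V * M) = plus (opL u * opX V) := by
  have h : opL u * opE V * M =
      opL u * opX V - opL u * (opX V * opL u - plus (opX V * opL u)) * M := by
    rw [hE, mul_sub, sub_mul, ← mul_assoc (opL u) (opX V), mul_assoc (opL u * opX V), hM.1, mul_one,
      sub_sub_cancel]
  have h0 := plus_eq_zero
    ((((ordLE_opL u).mul (ordLE_sub_plus (opX V * opL u))).mul hord).mono (M := -1) (by omega))
  rw [h, plus_sub, h0, sub_zero]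

end Operators

end

end GelfandDickey

theorem mainTheorem1 (𝕜 : Type*) [RCLike 𝕜] (n : ℕ) (hn : 1 ≤ n) :
    -- every leaf of `E` meets the transversal submanifold in exactly one point
    (∀ S ∈ leafS 𝕜 n, ∃! u : Fin n → Loop 𝕜, Proj S u) ∧
    -- existence and uniqueness of the lift `V = φ(v)`
    (∀ (lam : 𝕜) (u v : Fin n → Loop 𝕜), ∃! V : Mat 𝕜 n, IsTransversalLift lam u v V) ∧
    -- existence and uniqueness of the reduced Poisson pencil
    ∃ T₀ T₁ : (Fin n → Loop 𝕜) → (Fin n → Loop 𝕜) → (Fin n → Loop 𝕜),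
      (∀ T, IsReducedTensor (P₀ (𝕜 := 𝕜)) T ↔ T = T₀) ∧
      (∀ T, IsReducedTensor (P₁ (𝕜 := 𝕜)) T ↔ T = T₁) ∧
      (∀ (lam : 𝕜) T, IsReducedTensor (pencil lam) T ↔ T = fun u v => T₁ u v - lam • T₀ u v) ∧
      ∀ (lam : 𝕜) (u v : Fin n → Loop 𝕜) (V : Mat 𝕜 n), IsTransversalLift lam u v V →
        -- the reduced pencil is computed on the transversal submanifold by the lift `V`
        pencil lam (pointQ u) V = lastRow (T₁ u v - lam • T₀ u v) ∧
        -- `X` represents the covector `v` through the Adler trace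
        (∀ w, adlerTrace (opX V * opLdot w) = redPairing v w) ∧
        -- (i)
        opE V = plus (opX V * opL u) ∧
        -- (ii), where `M` is the inverse of `L`
        (∃ M, IsInverse (opL u) M ∧ (∀ M', IsInverse (opL u) M' → M' = M) ∧
          opLdot (T₁ u v) = opL u * opE V - plus (opL u * opE V * M) * opL u ∧
          opLdot (T₀ u v) = opE V - plus (opL u * opE V * M)) ∧
        -- (iii) for the tensors
        opLdot (T₁ u v) = agd₁ (opL u) (opX V) ∧
        opLdot (T₀ u v) = agd₀ (opL u) (opX V) ∧
        -- (iii) for the brackets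
        ∀ (v' : Fin n → Loop 𝕜) (V' : Mat 𝕜 n), IsTransversalLift lam u v' V' →
          redPairing v' (T₁ u v) = adlerTrace (opX V' * agd₁ (opL u) (opX V)) ∧
          redPairing v' (T₀ u v) = adlerTrace (opX V' * agd₀ (opL u) (opX V)) := by
  refine ⟨fun S hS => ⟨invariants S, (proj_iff hn hS).2 rfl, fun u hu => (proj_iff hn hS).1 hu⟩,
    fun lam u v => ?_, redTensor₀ hn, redTensor₁ hn,
    fun T => ⟨fun h => h.unique hn (isReducedTensor₀ hn), fun h => h ▸ isReducedTensor₀ hn⟩,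
    fun T => ⟨fun h => h.unique hn (isReducedTensor₁ hn), fun h => h ▸ isReducedTensor₁ hn⟩,
    fun lam T => ⟨fun h => h.unique hn (isReducedTensor_pencil hn lam),
      fun h => h ▸ isReducedTensor_pencil hn lam⟩, fun lam u v V hV => ?_⟩
  · obtain ⟨V, hV⟩ := exists_isTransversalLift hn lam u v
    exact ⟨V, hV, fun W hW => hW.unique hn hV⟩
  · obtain ⟨hE, -⟩ := hV.operators hn
    obtain ⟨h₁, h₀⟩ := hV.opLdot_eq hn
    obtain ⟨M, hM, hord⟩ := exists_inverse_opL u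
    have hc := plus_conj u hE hM hord
    have a₁ : opLdot (redTensor₁ hn u v) = agd₁ (opL u) (opX V) := by rw [h₁, hE, agd₁]
    have a₀ : opLdot (redTensor₀ hn u v) = agd₀ (opL u) (opX V) := by
      rw [h₀, hE, agd₀, plus_sub]
    refine ⟨hV.pencil_eq_lastRow hn, hV.adlerTrace_eq, hE,
      ⟨M, hM, fun M' hM' => hM.unique hM', ?_, ?_⟩, a₁, a₀, fun v' V' hV' => ⟨?_, ?_⟩⟩
    · rw [hc, h₁]
    · rw [hc, h₀]
    -- The brackets follow from the representation of `v'` by `X'`, applied to the reduced vector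
    -- itself.
    · rw [← a₁, hV'.adlerTrace_eq]
    · rw [← a₀, hV'.adlerTrace_eq]
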